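/- Let $\mathcal H^2$ be the hyperbolic plane (complete, simply connected, two-dimensional, constant curvature $-1$), in any of its models, i.e. any metric space isometric to the upper half-plane with metric $(dx^2+dy^2)/y^2$, with the Riemannian structure carried over by the isometry. Let $m_1,m_2,k>0$ and consider the two-body problem on $(\mathcal H^2\times\mathcal H^2)\setminus\{\text{collisions}\}$ with Lagrangian $$L=\tfrac12\left(m_1\|v_1\|^2+m_2\|v_2\|^2\right)+k\,m_1m_2\coth(d),$$ where $d$ is the hyperbolic distance between the masses. All solutions below are collision-free solutions of the Euler--Lagrange equations defined for all $t\in\mathbb R$. The hyperbolic center of mass of the two masses is the point on the geodesic segment joining them whose distances $d_1,d_2$ to $m_1,m_2$ satisfy $m_1\sinh(2d_1)=m_2\sinh(2d_2)$. A hyperbolic relative equilibrium is a solution of the form $x_i(t)=\exp(t\xi)\cdot x_i(0)$, $i=1,2$, where $SL(2,\mathbb R)$ acts diagonally by M\"obius transformations and $\xi\in\mathfrak{sl}(2,\mathbb R)$ is hyperbolic (it has real eigenvalues $\pm r$ with $r\ne 0$). Tangent vectors $u_1,u_2$ perpendicular to a geodesic $\ell$ at two of its points are equally oriented if $\{u_1,\dot\ell\}$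 and $\{u_2,\dot\ell\}$ define the same orientation. Theorem. (A) A solution is a hyperbolic relative equilibrium if and only if it has the following description. At every instant the hyperbolic center of mass exists and is unique, and there is $\omega\in\mathbb R$ such that, with $d_i$ the distance from the mass $m_i$ to the center of mass and $d=d_1+d_2$ the distance between the masses, $$\omega^2=\frac{2km_1}{\sinh^2(d)\sinh(2d_2)}=\frac{2km_2}{\sinh^2(d)\sinh(2d_1)},$$ and, at every instant: (i) $d_1$ and $d_2$ are constant in time; (ii) the velocity vectors $v_1,v_2$ are perpendicular to the geodesic containing the two masses and are equally oriented; (iii) the hyperbolic norm of $v_i$ is constant and equal to $|\omega|\cosh(d_i)$, $i=1,2$; (iv) the center of mass moves along a fixed geodesic, which at every instant is perpendicular at the center of mass to the geodesic containing the masses, and its velocity vector has constant hyperbolic norm $|\omega|$. (B) For any two distinct positions of the masses there are initial velocities which are perpendicular to the geodesic through the masses, equally oriented, and of hyperbolic norms $|\omega|\cosh(d_1)$ and $|\omega|\cosh(d_2)$, where $d_1,d_2$ are the distances from the masses to their hyperbolic center of mass and $\omega$ satisfies the above relation. For any initial data of this kind there is exactly one solution with these initial data, and it is a hyperbolic relative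 equilibrium. -/

import Mathlib

open scoped UpperHalfPlane MatrixGroups

noncomputable section

namespace HypTwoBody

/-! ### The Riemannian structure of the upper half-plane

`UpperHalfPlane` (written `ℍ`) carries the hyperbolic distance of curvature `-1`. Tangent vectors at
`z : ℍ` are complex numbers, and the Riemannian metric is `(dx ^ 2 + dy ^ 2) / y ^ 2`. -/

/-- The hyperbolic inner product of two tangent vectors `u`, `w` at a point `z` with `z.im > 0`. -/
def hypInner (z u w : ℂ) : ℝ := (u.re * w.re + u.im * w.im) / z.im ^ 2

/-- The hyperbolic norm of a tangent vector `u` at `z`. -/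
def hypNorm (z u : ℂ) : ℝ := Real.sqrt (hypInner z u u)

/-- The determinant of the pair `(u, w)`. Its sign is the orientation of the basis `{u, w}`. -/
def orient (u w : ℂ) : ℝ := u.re * w.im - u.im * w.re

/-! ### Models of the hyperbolic plane

A model of the hyperbolic plane is a metric space `M` together with an isometry `e` onto `ℍ`.
Through `e` it carries the Riemannian structure of `ℍ`; tangent vectors of `M` are written in the
coordinate `e`. -/

variable {M : Type*} [MetricSpace M]

/-- The coordinate of a point. -/
def coord (e : M ≃ᵢ ℍ) (a : M) : ℂ := (e a : ℂ)

/-- The curve `x` is differentiable at time `t` with velocity vector `v`. -/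
def HasVelocity (e : M ≃ᵢ ℍ) (x : ℝ → M) (v : ℂ) (t : ℝ) : Prop :=
  HasDerivAt (fun s => coord e (x s)) v t

/-- A complete geodesic parametrized by arc length; in the hyperbolic plane these are the
distance-preserving maps from the real line. -/
def IsGeodesic (l : ℝ → M) : Prop := Isometry l

/-- `c` is a hyperbolic center of mass of the masses `m₁` at `a₁` and `m₂` at `a₂`: it lies on a
geodesic connecting `a₁` and `a₂`, between these points, and
`m₁ sinh (2 d₁) = m₂ sinh (2 d₂)` for its distances `d₁`, `d₂` to the masses. -/
def IsCenterOfMass (m₁ m₂ : ℝ) (a₁ a₂ c : M) : Prop :=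
  (∃ (l : ℝ → M) (s₁ s s₂ : ℝ), IsGeodesic l ∧ s₁ ≤ s ∧ s ≤ s₂ ∧
    l s₁ = a₁ ∧ l s = c ∧ l s₂ = a₂) ∧
  m₁ * Real.sinh (2 * dist c a₁) = m₂ * Real.sinh (2 * dist c a₂)

/-! ### The two-body problem -/

/-- The potential `V(d) = - k m₁ m₂ coth d`. -/
def potential (k m₁ m₂ d : ℝ) : ℝ := -(k * m₁ * m₂ * (Real.cosh d / Real.sinh d))

/-- The Lagrangian in the coordinates of `ℍ × ℍ`: kinetic energy minus potential. On complex numbers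
with positive imaginary part `UpperHalfPlane.ofComplex` is the identification with `ℍ`. -/
def lagrangian (k m₁ m₂ : ℝ) (q v : ℂ × ℂ) : ℝ :=
  (m₁ * hypInner q.1 v.1 v.1 + m₂ * hypInner q.2 v.2 v.2) / 2 -
    potential k m₁ m₂ (dist (UpperHalfPlane.ofComplex q.1) (UpperHalfPlane.ofComplex q.2))

/-- `(x₁, x₂)` is a collision-free solution, for all times, of the Euler-Lagrange equations
`d/dt (∂L/∂v) = ∂L/∂q`. -/
def IsMotion (e : M ≃ᵢ ℍ) (k m₁ m₂ : ℝ) (x₁ x₂ : ℝ → M) : Prop :=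
  (∀ t, x₁ t ≠ x₂ t) ∧
  ∃ v : ℝ → ℂ × ℂ,
    (∀ t, HasVelocity e x₁ (v t).1 t ∧ HasVelocity e x₂ (v t).2 t) ∧
    ∀ t, HasDerivAt
      (fun s => fderiv ℝ
        (fun w => lagrangian k m₁ m₂ (coord e (x₁ s), coord e (x₂ s)) w) (v s))
      (fderiv ℝ (fun q => lagrangian k m₁ m₂ q (v t)) (coord e (x₁ t), coord e (x₂ t))) t

/-- Hyperbolic elements of `𝔰𝔩(2, ℝ)`: the trace vanishes and there are two real non-zero
eigenvalues with the same absolute value and opposite signs. -/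
def IsHyperbolicElement (ξ : Matrix (Fin 2) (Fin 2) ℝ) : Prop :=
  ξ.trace = 0 ∧ ∃ r : ℝ, r ≠ 0 ∧
    Module.End.HasEigenvalue (Matrix.toLin' ξ) r ∧ Module.End.HasEigenvalue (Matrix.toLin' ξ) (-r)

/-- A hyperbolic relative equilibrium: a solution that is the orbit of its initial state under
`t ↦ exp (t ξ)`, with `ξ` hyperbolic and `SL(2, ℝ)` acting by Möbius transformations. -/
def IsHyperbolicRelEquilibrium (e : M ≃ᵢ ℍ) (k m₁ m₂ : ℝ) (x₁ x₂ : ℝ → M) : Prop :=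
  IsMotion e k m₁ m₂ x₁ x₂ ∧
  ∃ ξ : Matrix (Fin 2) (Fin 2) ℝ, IsHyperbolicElement ξ ∧
    ∀ t : ℝ, ∃ g : SL(2, ℝ), (g : Matrix (Fin 2) (Fin 2) ℝ) = NormedSpace.exp (t • ξ) ∧
      e (x₁ t) = g • e (x₁ 0) ∧ e (x₂ t) = g • e (x₂ 0)

/-! ### The intrinsic description -/

/-- The two expressions for `ω ^ 2` in terms of the distances `d₁`, `d₂` of the masses to their
center of mass. -/
def OmegaRelation (k m₁ m₂ d₁ d₂ ω : ℝ) : Prop :=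
  ω ^ 2 = 2 * k * m₁ / (Real.sinh (d₁ + d₂) ^ 2 * Real.sinh (2 * d₂)) ∧
  ω ^ 2 = 2 * k * m₂ / (Real.sinh (d₁ + d₂) ^ 2 * Real.sinh (2 * d₁))

/-- `l` is a geodesic through `a₁` and `a₂`, and the tangent vectors `u₁`, `u₂` at these points are
perpendicular to `l` and equally oriented. -/
def PerpEquallyOriented (e : M ≃ᵢ ℍ) (l : ℝ → M) (a₁ a₂ : M) (u₁ u₂ : ℂ) : Prop :=
  IsGeodesic l ∧ ∃ (s₁ s₂ : ℝ) (w₁ w₂ : ℂ), l s₁ = a₁ ∧ l s₂ = a₂ ∧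
    HasVelocity e l w₁ s₁ ∧ HasVelocity e l w₂ s₂ ∧
    hypInner (coord e a₁) u₁ w₁ = 0 ∧ hypInner (coord e a₂) u₂ w₂ = 0 ∧
    0 < orient u₁ w₁ * orient u₂ w₂

/-- The geodesics `l` and `p` meet perpendicularly at the point `c`. -/
def PerpAt (e : M ≃ᵢ ℍ) (l p : ℝ → M) (c : M) : Prop :=
  ∃ (s τ : ℝ) (w n : ℂ), l s = c ∧ p τ = c ∧ HasVelocity e l w s ∧ HasVelocity e p n τ ∧
    hypInner (coord e c) w n = 0

/-- The state (positions `a₁`, `a₂` and velocities `u₁`, `u₂`) at a single instant: velocities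
perpendicular to the connecting geodesic and equally oriented, of norm `|ω| cosh dᵢ`. -/
def InstantDescription (e : M ≃ᵢ ℍ) (k m₁ m₂ : ℝ) (a₁ a₂ : M) (u₁ u₂ : ℂ) : Prop :=
  ∃ (c : M) (ω : ℝ), IsCenterOfMass m₁ m₂ a₁ a₂ c ∧
    OmegaRelation k m₁ m₂ (dist a₁ c) (dist a₂ c) ω ∧
    (∃ l : ℝ → M, PerpEquallyOriented e l a₁ a₂ u₁ u₂) ∧
    hypNorm (coord e a₁) u₁ = |ω| * Real.cosh (dist a₁ c) ∧
    hypNorm (coord e a₂) u₂ = |ω| * Real.cosh (dist a₂ c)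

/-- The intrinsic description of the whole motion: the center of mass `C t` is well defined, and
1. its distances `d₁`, `d₂` to the masses are constant (and `ω` is given by `OmegaRelation`);
2. at every time the velocities are perpendicular to the geodesic through the masses and equally
   oriented;
3. their norms are `|ω| cosh d₁` and `|ω| cosh d₂`;
4. `C t` moves along a fixed geodesic `p`, perpendicular at every time to the geodesic through the
   masses, with velocity of norm `|ω|`. -/
def IntrinsicDescription (e : M ≃ᵢ ℍ) (k m₁ m₂ : ℝ) (x₁ x₂ : ℝ → M) : Prop :=
  ∃ (C : ℝ → M) (d₁ d₂ ω : ℝ) (p : ℝ → M),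
    (∀ t c, IsCenterOfMass m₁ m₂ (x₁ t) (x₂ t) c ↔ c = C t) ∧
    OmegaRelation k m₁ m₂ d₁ d₂ ω ∧ IsGeodesic p ∧
    ∀ t, dist (x₁ t) (C t) = d₁ ∧ dist (x₂ t) (C t) = d₂ ∧ dist (x₁ t) (x₂ t) = d₁ + d₂ ∧
      ∃ (l : ℝ → M) (v₁ v₂ v : ℂ),
        HasVelocity e x₁ v₁ t ∧ HasVelocity e x₂ v₂ t ∧ HasVelocity e C v t ∧
        PerpEquallyOriented e l (x₁ t) (x₂ t) v₁ v₂ ∧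
        hypNorm (coord e (x₁ t)) v₁ = |ω| * Real.cosh d₁ ∧
        hypNorm (coord e (x₂ t)) v₂ = |ω| * Real.cosh d₂ ∧
        PerpAt e l p (C t) ∧
        hypNorm (coord e (C t)) v = |ω|

end HypTwoBody

end

/-! In Fermi coordinates along the imaginary axis the one-parameter group with this axis is the
shift of the second coordinate. A hyperbolic `ξ` is conjugate in `SL(2, ℝ)` to a diagonal matrix, so
after a Möbius change of chart a hyperbolic relative equilibrium reads `fermi sᵢ (τᵢ + ω * t)`, `i =
1, 2`.

As a complex number such an orbit is `exp (ω * t) * z`, with velocity `ω` times and second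
derivative `ω ^ 2` times the position. Newton's equations thus become algebraic (`accel_orbit_iff`,
`accel_fermi_iff`). They say that both positions have the same modulus, so that the geodesic through
the masses is perpendicular to the axis, and that one scalar balance holds for each mass. The signs
in the two balances put the masses on opposite sides of the axis, and comparing them gives `m₁ sinh
(2 d₁) = m₂ sinh (2 d₂)`: the common foot point is the center of mass (`balance_of_orbit`). The
intrinsic description is then read off from the coordinates.

Conversely, a state satisfying `InstantDescription` can be moved to the unit semicircle with center
of mass at `I`. There a vector perpendicular to the semicircle is a real multiple of the position;
the norms and the equal orientation force the same multiple, `ω` or `-ω`, for both masses. The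
translation orbit with this speed is a solution with the given data
(`InstantDescription.exists_motion`). With uniqueness for the initial value problem
(`IsMotion.unique`) this gives (B) and, applied to the state at time `0`, the remaining half of (A).

Two tools support this: the Euler-Lagrange equations are equivalent to Newton's equations in complex
form (`isMotion_iff`), and these are covariant under Möbius transformations (`IsNewton.moveChart`),
which permits the choice of chart. -/

namespace HypTwoBody

variable {M : Type*} [MetricSpace M]

/-! ### Fermi coordinates along the imaginary axis -/

/-- The point at signed distance `s` from the imaginary axis whose foot point is `exp t * I`. -/
noncomputable def fermi (s t : ℝ) : ℍ :=
  ⟨⟨Real.exp t * (Real.sinh s / Real.cosh s), Real.exp t * (1 / Real.cosh s)⟩, by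
    have := Real.cosh_pos s; positivity⟩

theorem fermi_re (s t : ℝ) : (fermi s t : ℂ).re = Real.exp t * (Real.sinh s / Real.cosh s) := rfl

theorem fermi_im (s t : ℝ) : (fermi s t : ℂ).im = Real.exp t * (1 / Real.cosh s) := rfl

theorem re_fermi (s t : ℝ) : (fermi s t).re = Real.exp t * (Real.sinh s / Real.cosh s) := rfl

theorem im_fermi (s t : ℝ) : (fermi s t).im = Real.exp t * (1 / Real.cosh s) := rfl

theorem exists_fermi (z : ℍ) : ∃ s t, fermi s t = z := by
  have hy := z.im_pos
  have hR : 0 < Real.sqrt (z.re ^ 2 + z.im ^ 2) := by positivity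
  have hR2 := Real.sq_sqrt (show 0 ≤ z.re ^ 2 + z.im ^ 2 by positivity)
  set R := Real.sqrt (z.re ^ 2 + z.im ^ 2) with hRdef
  have hc : Real.cosh (Real.arsinh (z.re / z.im)) = R / z.im := by
    rw [Real.cosh_arsinh, hRdef, Real.sqrt_eq_iff_mul_self_eq (by positivity) (by positivity)]
    rw [← hRdef]; field_simp; nlinarith
  refine ⟨Real.arsinh (z.re / z.im), Real.log R, UpperHalfPlane.ext (Complex.ext ?_ ?_)⟩
  · rw [fermi_re, hc, Real.sinh_arsinh, Real.exp_log hR]; field_simp; rfl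
  · rw [fermi_im, hc, Real.exp_log hR]; field_simp; rfl

theorem cosh_dist_fermi (s t s' t' : ℝ) : Real.cosh (dist (fermi s t) (fermi s' t')) =
    Real.cosh s * Real.cosh s' * Real.cosh (t - t') - Real.sinh s * Real.sinh s' := by
  have h1 := Real.cosh_pos s
  have h2 := Real.cosh_pos s'
  have e1 := Real.exp_pos t
  have e2 := Real.exp_pos t'
  have q1 := Real.cosh_sq s
  have q2 := Real.cosh_sq s'
  rw [UpperHalfPlane.cosh_dist, Complex.dist_eq_re_im, Real.sq_sqrt (by positivity)]
  change 1 + (((fermi s t : ℂ).re - (fermi s' t' : ℂ).re) ^ 2 +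
    ((fermi s t : ℂ).im - (fermi s' t' : ℂ).im) ^ 2) /
    (2 * (fermi s t : ℂ).im * (fermi s' t' : ℂ).im) = _
  rw [fermi_re, fermi_re, fermi_im, fermi_im, Real.cosh_eq (t - t'), neg_sub, Real.exp_sub,
    Real.exp_sub]
  generalize Real.exp t = a at *
  generalize Real.exp t' = b at *
  generalize Real.cosh s = c at *
  generalize Real.cosh s' = d at *
  generalize Real.sinh s = p at *
  generalize Real.sinh s' = q at *
  field_simp
  linear_combination (-(a * d) ^ 2) * q1 - (b * c) ^ 2 * q2

theorem dist_eq_abs_of_cosh {α : Type*} [PseudoMetricSpace α] {a b : α} {r : ℝ}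
    (h : Real.cosh (dist a b) = Real.cosh r) : dist a b = |r| := by
  rw [← Real.cosh_abs r] at h
  exact Real.cosh_strictMonoOn.injOn (Set.mem_Ici.2 dist_nonneg) (Set.mem_Ici.2 (abs_nonneg r)) h

theorem dist_fermi_left (s s' t : ℝ) : dist (fermi s t) (fermi s' t) = |s - s'| := by
  apply dist_eq_abs_of_cosh
  rw [cosh_dist_fermi, sub_self, Real.cosh_zero, Real.cosh_sub, mul_one]

theorem dist_fermi_zero (t t' : ℝ) : dist (fermi 0 t) (fermi 0 t') = |t - t'| := by
  apply dist_eq_abs_of_cosh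
  rw [cosh_dist_fermi]; simp

theorem fermi_injective_left {s s' t : ℝ} (h : fermi s t = fermi s' t) : s = s' := by
  have := dist_fermi_left s s' t
  rw [h, dist_self, eq_comm, abs_eq_zero] at this
  linarith

/-- A point is determined by its distances to two points of a geodesic if these are the distances
of a point of the geodesic. -/
theorem eq_fermi_of_dist {s₁ s₂ s : ℝ} {z : ℍ} (h : s₁ ≠ s₂)
    (h₁ : dist z (fermi s₁ 0) = |s - s₁|) (h₂ : dist z (fermi s₂ 0) = |s - s₂|) :
    z = fermi s 0 := by
  obtain ⟨σ, τ, rfl⟩ := exists_fermi z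
  replace h₁ := congrArg Real.cosh h₁
  replace h₂ := congrArg Real.cosh h₂
  rw [cosh_dist_fermi, sub_zero, Real.cosh_abs, Real.cosh_sub s] at h₁ h₂
  have hs : Real.sinh (s₁ - s₂) ≠ 0 := by
    rw [Ne, Real.sinh_eq_zero]; exact sub_ne_zero.2 h
  rw [Real.sinh_sub] at hs
  -- Both distance equations are linear in `sinh σ` and `cosh σ * cosh τ`. Eliminating the latter
  -- leaves `sinh σ` with the coefficient `sinh (s₁ - s₂)`.
  have hA : Real.sinh σ = Real.sinh s := by
    apply mul_right_cancel₀ hs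
    linear_combination (Real.cosh s₁) * h₂ - (Real.cosh s₂) * h₁
  obtain rfl : σ = s := Real.sinh_injective hA
  have hB : Real.cosh τ = 1 := by
    apply mul_right_cancel₀ (mul_pos (Real.cosh_pos σ) (Real.cosh_pos s₁)).ne'
    linear_combination h₁
  have hτ : Real.sinh τ = 0 := by
    have := Real.cosh_sq τ
    rw [hB] at this
    exact pow_eq_zero_iff two_ne_zero |>.1 (by linarith)
  rw [Real.sinh_eq_zero.1 hτ]

/-! ### Moving geodesics by isometries -/

theorem sl_coe_smul (g : SL(2, ℝ)) (z : ℍ) : ((g • z : ℍ) : ℂ) =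
    ((g 0 0 : ℂ) * z + (g 0 1 : ℂ)) / ((g 1 0 : ℂ) * z + (g 1 1 : ℂ)) := by
  simpa using UpperHalfPlane.coe_specialLinearGroup_apply g z

theorem sl_det (g : SL(2, ℝ)) : g 0 0 * g 1 1 - g 0 1 * g 1 0 = 1 := by
  have := g.det_coe
  rwa [Matrix.det_fin_two] at this

theorem sl_denom_ne_zero (g : SL(2, ℝ)) (z : ℍ) : (g 1 0 : ℂ) * z + (g 1 1 : ℂ) ≠ 0 := by
  intro h
  have h1 := congrArg Complex.im h
  have h2 := congrArg Complex.re h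
  have hd := sl_det g
  have hz : (z : ℂ).im ≠ 0 := z.im_pos.ne'
  simp at h1 h2
  rcases h1 with h1 | h1
  · rw [h1] at h2 hd; simp at h2; rw [h2] at hd; simp at hd
  · exact hz h1

/-- The diagonal elements of `SL(2, ℝ)`, translations along the imaginary axis. -/
noncomputable def translation (t : ℝ) : SL(2, ℝ) :=
  ⟨!![Real.exp (t / 2), 0; 0, Real.exp (-(t / 2))], by
    rw [Matrix.det_fin_two_of, ← Real.exp_add]; simp⟩

theorem translation_smul (t : ℝ) (z : ℍ) : ((translation t • z : ℍ) : ℂ) = Real.exp t * z := by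
  rw [sl_coe_smul]
  have : Real.exp t = Real.exp (t / 2) * Real.exp (t / 2) := by
    rw [← Real.exp_add]; congr 1; ring
  simp [translation, this, Complex.exp_neg]
  ring

theorem translation_smul_fermi (τ s t : ℝ) : translation τ • fermi s t = fermi s (t + τ) := by
  apply UpperHalfPlane.ext
  rw [translation_smul]
  apply Complex.ext
  · rw [Complex.re_ofReal_mul, fermi_re, fermi_re, Real.exp_add]; ring
  · rw [Complex.im_ofReal_mul, fermi_im, fermi_im, Real.exp_add]; ring

theorem fermi_zero_zero : fermi 0 0 = UpperHalfPlane.I := by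
  apply UpperHalfPlane.ext; apply Complex.ext <;> simp [re_fermi, im_fermi]

/-- Rotations around `I`. -/
noncomputable def rotation (θ : ℝ) : SL(2, ℝ) :=
  ⟨!![Real.cos θ, Real.sin θ; -Real.sin θ, Real.cos θ], by
    rw [Matrix.det_fin_two_of]; linear_combination Real.sin_sq_add_cos_sq θ⟩

theorem rotation_smul_I (θ : ℝ) : rotation θ • UpperHalfPlane.I = UpperHalfPlane.I := by
  apply UpperHalfPlane.ext
  rw [sl_coe_smul, div_eq_iff (sl_denom_ne_zero _ _)]
  apply Complex.ext <;> simp [rotation]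

/-- The Möbius map is `z ↦ -1 / z`, the half-turn about `I`, which reverses both the axis and the
semicircle. -/
theorem rotation_fermi (s t : ℝ) : rotation (Real.pi / 2) • fermi s t = fermi (-s) (-t) := by
  apply UpperHalfPlane.ext
  rw [sl_coe_smul, div_eq_iff (sl_denom_ne_zero _ _)]
  have h := Real.cosh_pos s
  have h2 := Real.cosh_sq s
  have h3 := Real.exp_pos t
  apply Complex.ext <;>
    simp [rotation, re_fermi, im_fermi, Real.exp_neg]
  · field_simp; linear_combination h2
  · field_simp; ring

theorem exists_rotation_smul_eq (z : ℍ) : ∃ θ s, rotation θ • z = fermi s 0 := by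
  -- The expression is the squared modulus of the numerator minus that of the denominator of
  -- `rotation θ • z`, so it vanishes exactly when the image has modulus one. Its values at `0` and
  -- `π / 2` are opposite.
  obtain ⟨θ, -, hθ⟩ : ∃ θ ∈ Set.univ, (Real.cos θ ^ 2 - Real.sin θ ^ 2) * (Complex.normSq z - 1) +
      4 * Real.cos θ * Real.sin θ * z.re = 0 := by
    have hf : Continuous fun θ => (Real.cos θ ^ 2 - Real.sin θ ^ 2) * (Complex.normSq z - 1) +
      4 * Real.cos θ * Real.sin θ * z.re := by fun_prop
    rcases le_total (Complex.normSq z - 1) 0 with h | h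
    · obtain ⟨θ, hθ⟩ := mem_range_of_exists_le_of_exists_ge (c := 0) hf ⟨0, by simpa using h⟩
        ⟨Real.pi / 2, by simpa using h⟩
      exact ⟨θ, trivial, hθ⟩
    · obtain ⟨θ, hθ⟩ := mem_range_of_exists_le_of_exists_ge (c := 0) hf
        ⟨Real.pi / 2, by simpa using h⟩ ⟨0, by simpa using h⟩
      exact ⟨θ, trivial, hθ⟩
  refine ⟨θ, ?_⟩
  obtain ⟨s, t, hst⟩ := exists_fermi (rotation θ • z)
  refine ⟨s, hst ▸ ?_⟩
  have hn : Complex.normSq (rotation θ • z : ℍ) = 1 := by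
    rw [sl_coe_smul, map_div₀, div_eq_one_iff_eq (Complex.normSq_pos.2 (sl_denom_ne_zero _ _)).ne']
    simp only [rotation, Complex.normSq_apply] at hθ ⊢
    simp [-Complex.ofReal_cos, -Complex.ofReal_sin] at hθ ⊢
    linear_combination hθ
  rw [← hst, Complex.normSq_apply, fermi_re, fermi_im] at hn
  have hc := Real.cosh_pos s
  have hc2 := Real.cosh_sq s
  have hE : Real.exp t * Real.exp t = 1 := by
    field_simp at hn
    have : Real.cosh s ^ 2 * (Real.exp t * Real.exp t - 1) = 0 := by
      linear_combination hn + Real.exp t ^ 2 * hc2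
    rcases mul_eq_zero.1 this with h | h
    · exact absurd h (by positivity)
    · linarith
  rw [← Real.exp_add, Real.exp_eq_one_iff] at hE
  rw [show t = 0 by linarith]

/-- Any pair of points can be moved to the unit semicircle. -/
theorem exists_smul_eq_fermi (a b : ℍ) :
    ∃ g : SL(2, ℝ), g • a = fermi 0 0 ∧ g • b = fermi (dist a b) 0 := by
  obtain ⟨g, hg⟩ := MulAction.exists_smul_eq SL(2, ℝ) a UpperHalfPlane.I
  obtain ⟨θ, s, hs⟩ := exists_rotation_smul_eq (g • b)
  have hd : dist a b = |s| := by
    rw [← dist_smul (rotation θ * g) a b, mul_smul, mul_smul, hs, hg, rotation_smul_I,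
      ← fermi_zero_zero, dist_fermi_left, zero_sub, abs_neg]
  rcases le_total 0 s with h | h
  · refine ⟨rotation θ * g, ?_, ?_⟩
    · rw [mul_smul, hg, rotation_smul_I, fermi_zero_zero]
    · rw [mul_smul, hs, hd, abs_of_nonneg h]
  · refine ⟨rotation (Real.pi / 2) * (rotation θ * g), ?_, ?_⟩
    · rw [mul_smul, mul_smul, hg, rotation_smul_I, rotation_smul_I, fermi_zero_zero]
    · rw [mul_smul, mul_smul, hs, rotation_fermi, hd, abs_of_nonpos h, neg_zero]

/-- Every complete geodesic can be moved to the unit semicircle. -/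
theorem exists_smul_isometry_eq {l : ℝ → ℍ} (hl : Isometry l) (s₀ : ℝ) :
    ∃ g : SL(2, ℝ), ∀ s, g • l s = fermi (s - s₀) 0 := by
  obtain ⟨g, h0, h1⟩ := exists_smul_eq_fermi (l s₀) (l (s₀ + 1))
  rw [hl.dist_eq, Real.dist_eq] at h1
  norm_num at h1
  refine ⟨g, fun s => eq_fermi_of_dist (zero_ne_one (α := ℝ)) ?_ ?_⟩
  · rw [← h0, dist_smul, hl.dist_eq, Real.dist_eq, sub_zero]
  · rw [← h1, dist_smul, hl.dist_eq, Real.dist_eq]; congr 1; ring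


/-- The chart `e` followed by the Möbius transformation `g`. -/
noncomputable def moveChart (e : M ≃ᵢ ℍ) (g : SL(2, ℝ)) : M ≃ᵢ ℍ :=
  e.trans (IsometryEquiv.constSMul g)

theorem moveChart_apply (e : M ≃ᵢ ℍ) (g : SL(2, ℝ)) (a : M) : moveChart e g a = g • e a := rfl

theorem moveChart_inv (e : M ≃ᵢ ℍ) (g : SL(2, ℝ)) : moveChart (moveChart e g) g⁻¹ = e := by
  ext a; simp [moveChart_apply]

theorem IsGeodesic.exists_chart (e : M ≃ᵢ ℍ) {l : ℝ → M} (hl : IsGeodesic l) (s₀ : ℝ) :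
    ∃ g : SL(2, ℝ), ∀ s, moveChart e g (l s) = fermi (s - s₀) 0 :=
  exists_smul_isometry_eq (e.isometry.comp hl) s₀

theorem isGeodesic_fermi_left (e : M ≃ᵢ ℍ) (t : ℝ) : IsGeodesic fun s => e.symm (fermi s t) :=
  e.symm.isometry.comp (Isometry.of_dist_eq fun s s' => by rw [dist_fermi_left, Real.dist_eq])

theorem isGeodesic_fermi_zero (e : M ≃ᵢ ℍ) : IsGeodesic fun t => e.symm (fermi 0 t) :=
  e.symm.isometry.comp (Isometry.of_dist_eq fun s s' => by rw [dist_fermi_zero, Real.dist_eq])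

theorem IsGeodesic.eq_of_dist (e : M ≃ᵢ ℍ) {l : ℝ → M} (hl : IsGeodesic l) {s₁ s₂ s : ℝ} {a : M}
    (h : s₁ ≠ s₂) (h₁ : dist a (l s₁) = |s - s₁|) (h₂ : dist a (l s₂) = |s - s₂|) : a = l s := by
  obtain ⟨g, hg⟩ := hl.exists_chart e 0
  apply (moveChart e g).injective
  simp only [sub_zero] at hg
  rw [hg]
  apply eq_fermi_of_dist h
  · rw [← hg, (moveChart e g).isometry.dist_eq, h₁]
  · rw [← hg, (moveChart e g).isometry.dist_eq, h₂]

/-! ### The center of mass -/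

theorem sinh_balance_unique {m₁ m₂ d a b : ℝ} (hm₁ : 0 < m₁) (hm₂ : 0 < m₂)
    (ha : m₁ * Real.sinh (2 * a) = m₂ * Real.sinh (2 * (d - a)))
    (hb : m₁ * Real.sinh (2 * b) = m₂ * Real.sinh (2 * (d - b))) : a = b := by
  have key : StrictMono fun x => m₁ * Real.sinh (2 * x) - m₂ * Real.sinh (2 * (d - x)) := by
    intro x y hxy
    have h1 : Real.sinh (2 * x) < Real.sinh (2 * y) := Real.sinh_lt_sinh.2 (by linarith)
    have h2 : Real.sinh (2 * (d - y)) < Real.sinh (2 * (d - x)) :=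
      Real.sinh_lt_sinh.2 (by linarith)
    have := mul_lt_mul_of_pos_left h1 hm₁
    have := mul_lt_mul_of_pos_left h2 hm₂
    show m₁ * Real.sinh (2 * x) - m₂ * Real.sinh (2 * (d - x)) <
      m₁ * Real.sinh (2 * y) - m₂ * Real.sinh (2 * (d - y))
    linarith
  apply key.injective
  show m₁ * Real.sinh (2 * a) - m₂ * Real.sinh (2 * (d - a)) =
      m₁ * Real.sinh (2 * b) - m₂ * Real.sinh (2 * (d - b))
  linarith

theorem exists_sinh_balance {m₁ m₂ d : ℝ} (hm₁ : 0 < m₁) (hm₂ : 0 < m₂) (hd : 0 ≤ d) :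
    ∃ a, 0 ≤ a ∧ a ≤ d ∧ m₁ * Real.sinh (2 * a) = m₂ * Real.sinh (2 * (d - a)) := by
  have hf : ContinuousOn (fun x => m₁ * Real.sinh (2 * x) - m₂ * Real.sinh (2 * (d - x)))
      (Set.Icc 0 d) := by
    apply Continuous.continuousOn; fun_prop
  have h2 : 0 ≤ Real.sinh (2 * d) := Real.sinh_nonneg_iff.2 (by linarith)
  obtain ⟨a, ha, h⟩ := intermediate_value_Icc hd hf (show (0 : ℝ) ∈ _ by
    constructor <;> simp <;> positivity)
  exact ⟨a, ha.1, ha.2, sub_eq_zero.1 h⟩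

theorem IsCenterOfMass.dist_add {m₁ m₂ : ℝ} {a₁ a₂ c : M} (h : IsCenterOfMass m₁ m₂ a₁ a₂ c) :
    dist a₁ c + dist a₂ c = dist a₁ a₂ := by
  obtain ⟨⟨l, s₁, s, s₂, hl, h1, h2, rfl, rfl, rfl⟩, -⟩ := h
  have hl : Isometry l := hl
  rw [hl.dist_eq, hl.dist_eq, hl.dist_eq, Real.dist_eq, Real.dist_eq, Real.dist_eq,
    abs_of_nonpos (by linarith), abs_of_nonneg (by linarith), abs_of_nonpos (by linarith)]
  ring

theorem IsCenterOfMass.balance {m₁ m₂ : ℝ} {a₁ a₂ c : M} (h : IsCenterOfMass m₁ m₂ a₁ a₂ c) :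
    m₁ * Real.sinh (2 * dist a₁ c) = m₂ * Real.sinh (2 * dist a₂ c) := by
  rw [dist_comm a₁, dist_comm a₂]; exact h.2

/-- The balance is strictly monotone in the position along the segment, so it fixes the distances to
both masses; these fix the point (`IsGeodesic.eq_of_dist`), even if the two centers were given on
different geodesics. -/
theorem isCenterOfMass_unique (e : M ≃ᵢ ℍ) {m₁ m₂ : ℝ} (hm₁ : 0 < m₁) (hm₂ : 0 < m₂) {a₁ a₂ c c' : M}
    (ha : a₁ ≠ a₂) (h : IsCenterOfMass m₁ m₂ a₁ a₂ c) (h' : IsCenterOfMass m₁ m₂ a₁ a₂ c') :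
    c' = c := by
  have h1 : dist a₁ c' = dist a₁ c := by
    apply sinh_balance_unique (d := dist a₁ a₂) hm₁ hm₂
    · rw [h'.balance, ← h'.dist_add]; ring_nf
    · rw [h.balance, ← h.dist_add]; ring_nf
  have h2 : dist a₂ c' = dist a₂ c := by linarith [h.dist_add, h'.dist_add]
  obtain ⟨⟨l, s₁, s, s₂, hl, -, -, rfl, rfl, rfl⟩, -⟩ := h
  apply hl.eq_of_dist e (s₁ := s₁) (s₂ := s₂) (fun hs => ha (by rw [hs]))
  · rw [dist_comm, h1, dist_comm, Isometry.dist_eq hl, Real.dist_eq]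
  · rw [dist_comm, h2, dist_comm, Isometry.dist_eq hl, Real.dist_eq]

theorem IsCenterOfMass.dist_pos {m₁ m₂ : ℝ} (hm₁ : 0 < m₁) (hm₂ : 0 < m₂) {a₁ a₂ c : M}
    (ha : a₁ ≠ a₂) (h : IsCenterOfMass m₁ m₂ a₁ a₂ c) : 0 < dist a₁ c ∧ 0 < dist a₂ c := by
  have hd := h.dist_add
  have hb := h.balance
  have hp := _root_.dist_pos.2 ha
  constructor
  · rcases (dist_nonneg (x := a₁) (y := c)).eq_or_lt with h0 | h0
    · rw [← h0] at hb hd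
      have : 0 < Real.sinh (2 * dist a₂ c) := Real.sinh_pos_iff.2 (by linarith)
      have := mul_pos hm₂ this
      rw [mul_zero, Real.sinh_zero, mul_zero] at hb; linarith
    · exact h0
  · rcases (dist_nonneg (x := a₂) (y := c)).eq_or_lt with h0 | h0
    · rw [← h0] at hb hd
      have : 0 < Real.sinh (2 * dist a₁ c) := Real.sinh_pos_iff.2 (by linarith)
      have := mul_pos hm₁ this
      rw [mul_zero, Real.sinh_zero, mul_zero] at hb; linarith
    · exact h0

theorem isCenterOfMass_of_chart (e : M ≃ᵢ ℍ) {m₁ m₂ : ℝ} {a₁ a₂ c : M} {s₁ s₂ t : ℝ}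
    (h1 : e a₁ = fermi s₁ t) (h2 : e a₂ = fermi s₂ t) (hc : e c = fermi 0 t)
    (hs : s₁ * s₂ ≤ 0) (hb : m₁ * Real.sinh (2 * |s₁|) = m₂ * Real.sinh (2 * |s₂|)) :
    IsCenterOfMass m₁ m₂ a₁ a₂ c := by
  have hd : ∀ {a b : M} {s s' : ℝ}, e a = fermi s t → e b = fermi s' t → dist a b = |s - s'| := by
    intro a b s s' ha hb
    rw [← e.isometry.dist_eq, ha, hb, dist_fermi_left]
  refine ⟨?_, by rw [hd hc h1, hd hc h2, zero_sub, zero_sub, abs_neg, abs_neg, hb]⟩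
  have hsymm : ∀ {a : M} {s : ℝ}, e a = fermi s t → e.symm (fermi s t) = a := fun h => by
    rw [← h, e.symm_apply_apply]
  rcases le_total s₁ s₂ with h | h
  · exact ⟨_, s₁, 0, s₂, isGeodesic_fermi_left e t, by nlinarith, by nlinarith, hsymm h1, hsymm hc,
      hsymm h2⟩
  -- `IsCenterOfMass` requires the parameter of the first mass to come first, so here the geodesic
  -- is run backwards.
  · refine ⟨fun s => e.symm (fermi (-s) t), -s₁, 0, -s₂, ?_, by nlinarith, by nlinarith, ?_, ?_, ?_⟩
    · exact (isGeodesic_fermi_left e t).comp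
        (Isometry.of_dist_eq fun s s' => by rw [Real.dist_eq, Real.dist_eq, ← abs_neg]; congr 1; ring)
    · simpa using hsymm h1
    · simpa using hsymm hc
    · simpa using hsymm h2

/-! ### Change of the chart -/

/-- The denominator of the Möbius transformation `g`. -/
def denom (g : SL(2, ℝ)) (z : ℂ) : ℂ := (g 1 0 : ℂ) * z + (g 1 1 : ℂ)

/-- The Möbius transformation `g` as a function on complex numbers. -/
noncomputable def mobius (g : SL(2, ℝ)) (z : ℂ) : ℂ := ((g 0 0 : ℂ) * z + (g 0 1 : ℂ)) / denom g z

/-- The derivative of the Möbius transformation `g`. -/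
noncomputable def slDeriv (g : SL(2, ℝ)) (z : ℂ) : ℂ := 1 / denom g z ^ 2

theorem coord_im_pos (e : M ≃ᵢ ℍ) (a : M) : 0 < (coord e a).im := (e a).im_pos

theorem denom_coord_ne_zero (g : SL(2, ℝ)) (e : M ≃ᵢ ℍ) (a : M) : denom g (coord e a) ≠ 0 :=
  sl_denom_ne_zero g (e a)

theorem slDeriv_coord_ne_zero (g : SL(2, ℝ)) (e : M ≃ᵢ ℍ) (a : M) : slDeriv g (coord e a) ≠ 0 :=
  one_div_ne_zero (pow_ne_zero 2 (denom_coord_ne_zero g e a))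

theorem coord_moveChart (e : M ≃ᵢ ℍ) (g : SL(2, ℝ)) (a : M) :
    coord (moveChart e g) a = mobius g (coord e a) := sl_coe_smul g (e a)

theorem sl_det_complex (g : SL(2, ℝ)) :
    (g 0 0 : ℂ) * (g 1 1 : ℂ) - (g 0 1 : ℂ) * (g 1 0 : ℂ) = 1 := by
  exact_mod_cast sl_det g

/-- This is where determinant one enters. Since `mobius g` commutes with conjugation, the case `w =
conj z` gives the imaginary part, and the covariance of `pull` follows as well. -/
theorem mobius_sub {g : SL(2, ℝ)} {z w : ℂ} (hz : denom g z ≠ 0) (hw : denom g w ≠ 0) :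
    mobius g z - mobius g w = (z - w) / (denom g z * denom g w) := by
  have h := sl_det_complex g
  rw [mobius, mobius, div_sub_div _ _ hz hw]
  congr 1
  rw [denom, denom]
  linear_combination (z - w) * h

theorem conj_denom (g : SL(2, ℝ)) (z : ℂ) : starRingEnd ℂ (denom g z) = denom g (starRingEnd ℂ z) := by
  simp [denom]

theorem conj_mobius (g : SL(2, ℝ)) (z : ℂ) :
    starRingEnd ℂ (mobius g z) = mobius g (starRingEnd ℂ z) := by
  simp [denom, mobius]

theorem denom_conj_ne_zero {g : SL(2, ℝ)} {z : ℂ} (hz : denom g z ≠ 0) :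
    denom g (starRingEnd ℂ z) ≠ 0 := by
  rw [← conj_denom]; simpa using hz

theorem ofReal_im_eq (z : ℂ) : (z.im : ℂ) = (z - starRingEnd ℂ z) / (2 * Complex.I) := by
  rw [Complex.sub_conj]; field_simp; push_cast; ring

theorem im_mobius {g : SL(2, ℝ)} {z : ℂ} (hz : denom g z ≠ 0) :
    ((mobius g z).im : ℂ) = z.im / (denom g z * denom g (starRingEnd ℂ z)) := by
  rw [ofReal_im_eq, conj_mobius, mobius_sub hz (denom_conj_ne_zero hz), ofReal_im_eq z]
  ring

theorem im_mobius_real {g : SL(2, ℝ)} {z : ℂ} (hz : denom g z ≠ 0) :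
    (mobius g z).im = z.im / Complex.normSq (denom g z) := by
  have := im_mobius hz
  rw [← conj_denom, Complex.mul_conj] at this
  exact_mod_cast this

theorem hasDerivAt_denom (g : SL(2, ℝ)) {z : ℝ → ℂ} {v : ℂ} {t : ℝ} (h : HasDerivAt z v t) :
    HasDerivAt (fun s => denom g (z s)) (g 1 0 * v) t :=
  (h.const_mul _).add_const _

theorem hasDerivAt_mobius (g : SL(2, ℝ)) {z : ℝ → ℂ} {v : ℂ} {t : ℝ} (h : HasDerivAt z v t)
    (hz : denom g (z t) ≠ 0) : HasDerivAt (fun s => mobius g (z s)) (slDeriv g (z t) * v) t := by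
  have h1 : HasDerivAt (fun s => (g 0 0 : ℂ) * z s + (g 0 1 : ℂ)) (g 0 0 * v) t :=
    (h.const_mul _).add_const _
  refine (h1.fun_div (hasDerivAt_denom g h) hz).congr_deriv ?_
  symm
  rw [slDeriv, one_div, inv_mul_eq_div]
  congr 1
  rw [denom]
  linear_combination (-v) * sl_det_complex g

theorem HasVelocity.moveChart {e : M ≃ᵢ ℍ} {x : ℝ → M} {v : ℂ} {t : ℝ} (h : HasVelocity e x v t)
    (g : SL(2, ℝ)) : HasVelocity (moveChart e g) x (slDeriv g (coord e (x t)) * v) t := by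
  have := hasDerivAt_mobius g h (denom_coord_ne_zero g e (x t))
  simp only [← coord_moveChart] at this
  exact this

theorem normSq_slDeriv (g : SL(2, ℝ)) (z : ℂ) :
    Complex.normSq (slDeriv g z) = 1 / Complex.normSq (denom g z) ^ 2 := by
  simp [slDeriv]

/-- The squared modulus of the derivative is `normSq (denom g z) ^ (-2)`, and the squared imaginary
part acquires the same factor. -/
theorem hypInner_moveChart (e : M ≃ᵢ ℍ) (g : SL(2, ℝ)) (a : M) (u w : ℂ) :
    hypInner (coord (moveChart e g) a) (slDeriv g (coord e a) * u) (slDeriv g (coord e a) * w) =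
      hypInner (coord e a) u w := by
  have hd := denom_coord_ne_zero g e a
  have h1 := Complex.normSq_pos.2 hd
  have hn := normSq_slDeriv g (coord e a)
  rw [Complex.normSq_apply (slDeriv _ _)] at hn
  have hy := coord_im_pos e a
  rw [hypInner, hypInner, coord_moveChart, im_mobius_real hd, Complex.mul_re, Complex.mul_im,
    Complex.mul_re, Complex.mul_im]
  rw [div_eq_div_iff (by positivity) (by positivity), div_pow]
  have hn' := hn
  field_simp at hn'
  field_simp
  linear_combination (u.re * w.re + u.im * w.im) * hn'

theorem hypNorm_moveChart (e : M ≃ᵢ ℍ) (g : SL(2, ℝ)) (a : M) (u : ℂ) :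
    hypNorm (coord (moveChart e g) a) (slDeriv g (coord e a) * u) = hypNorm (coord e a) u := by
  rw [hypNorm, hypInner_moveChart, hypNorm]

theorem orient_mul (j u w : ℂ) : orient (j * u) (j * w) = Complex.normSq j * orient u w := by
  simp only [orient, Complex.mul_re, Complex.mul_im, Complex.normSq_apply]; ring

theorem PerpEquallyOriented.moveChart {e : M ≃ᵢ ℍ} {l : ℝ → M} {a₁ a₂ : M} {u₁ u₂ : ℂ}
    (h : PerpEquallyOriented e l a₁ a₂ u₁ u₂) (g : SL(2, ℝ)) :
    PerpEquallyOriented (moveChart e g) l a₁ a₂ (slDeriv g (coord e a₁) * u₁)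
      (slDeriv g (coord e a₂) * u₂) := by
  obtain ⟨hl, s₁, s₂, w₁, w₂, rfl, rfl, hv₁, hv₂, h₁, h₂, ho⟩ := h
  refine ⟨hl, s₁, s₂, _, _, rfl, rfl, hv₁.moveChart g, hv₂.moveChart g, ?_, ?_, ?_⟩
  · rw [hypInner_moveChart, h₁]
  · rw [hypInner_moveChart, h₂]
  · rw [orient_mul, orient_mul, mul_mul_mul_comm]
    exact mul_pos (mul_pos (Complex.normSq_pos.2 (slDeriv_coord_ne_zero g e _))
      (Complex.normSq_pos.2 (slDeriv_coord_ne_zero g e _))) ho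

theorem PerpAt.moveChart {e : M ≃ᵢ ℍ} {l p : ℝ → M} {c : M} (h : PerpAt e l p c) (g : SL(2, ℝ)) :
    PerpAt (moveChart e g) l p c := by
  obtain ⟨s, τ, w, n, rfl, hp, hw, hn, h⟩ := h
  refine ⟨s, τ, _, _, rfl, hp, hw.moveChart g, hn.moveChart g, ?_⟩
  rw [hp, hypInner_moveChart, h]

theorem InstantDescription.moveChart {e : M ≃ᵢ ℍ} {k m₁ m₂ : ℝ} {a₁ a₂ : M} {u₁ u₂ : ℂ}
    (h : InstantDescription e k m₁ m₂ a₁ a₂ u₁ u₂) (g : SL(2, ℝ)) :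
    InstantDescription (moveChart e g) k m₁ m₂ a₁ a₂ (slDeriv g (coord e a₁) * u₁)
      (slDeriv g (coord e a₂) * u₂) := by
  obtain ⟨c, ω, hc, hω, ⟨l, hl⟩, h₁, h₂⟩ := h
  refine ⟨c, ω, hc, hω, ⟨l, hl.moveChart g⟩, ?_, ?_⟩
  · rw [hypNorm_moveChart, h₁]
  · rw [hypNorm_moveChart, h₂]

theorem IntrinsicDescription.moveChart {e : M ≃ᵢ ℍ} {k m₁ m₂ : ℝ} {x₁ x₂ : ℝ → M}
    (h : IntrinsicDescription e k m₁ m₂ x₁ x₂) (g : SL(2, ℝ)) :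
    IntrinsicDescription (moveChart e g) k m₁ m₂ x₁ x₂ := by
  obtain ⟨C, d₁, d₂, ω, p, hC, hω, hp, h⟩ := h
  refine ⟨C, d₁, d₂, ω, p, hC, hω, hp, fun t => ?_⟩
  obtain ⟨h1, h2, h3, l, v₁, v₂, v, hv₁, hv₂, hv, hl, n₁, n₂, hlp, n⟩ := h t
  refine ⟨h1, h2, h3, l, _, _, _, hv₁.moveChart g, hv₂.moveChart g, hv.moveChart g,
    hl.moveChart g, ?_, ?_, hlp.moveChart g, ?_⟩
  · rw [hypNorm_moveChart, n₁]
  · rw [hypNorm_moveChart, n₂]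
  · rw [hypNorm_moveChart, n]

/-! ### Newton's equations -/

/-- The hyperbolic cosine of the distance of two points of the upper half-plane. -/
noncomputable def coshDist (z w : ℂ) : ℝ :=
  1 + ((z.re - w.re) ^ 2 + (z.im - w.im) ^ 2) / (2 * z.im * w.im)

theorem coshDist_coe (z w : ℍ) : coshDist z w = Real.cosh (dist z w) := by
  rw [UpperHalfPlane.cosh_dist, Complex.dist_eq_re_im, Real.sq_sqrt (by positivity)]; rfl

theorem coshDist_comm (z w : ℂ) : coshDist z w = coshDist w z := by
  simp only [coshDist]; ring

/-- The hyperbolic sine of the distance of two points of the upper half-plane. -/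
noncomputable def sinhDist (z w : ℂ) : ℝ := Real.sqrt (coshDist z w ^ 2 - 1)

theorem sinhDist_coe (z w : ℍ) : sinhDist z w = Real.sinh (dist z w) := by
  rw [sinhDist, coshDist_coe, Real.cosh_sq, add_sub_cancel_right, Real.sqrt_sq]
  exact Real.sinh_nonneg_iff.2 dist_nonneg

theorem sinhDist_coord (e : M ≃ᵢ ℍ) (a b : M) :
    sinhDist (coord e a) (coord e b) = Real.sinh (dist a b) := by
  rw [← e.isometry.dist_eq, ← sinhDist_coe]; rfl

theorem one_lt_coshDist (e : M ≃ᵢ ℍ) {a b : M} (h : a ≠ b) :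
    1 < coshDist (coord e a) (coord e b) := by
  have := coshDist_coe (e a) (e b)
  rw [e.isometry.dist_eq] at this
  change 1 < coshDist (e a) (e b)
  rw [this, Real.one_lt_cosh]
  exact dist_ne_zero.2 h

/-- The acceleration of a mass at `z` caused by a unit mass at `w`. -/
noncomputable def pull (z w : ℂ) : ℂ :=
  Complex.I * (z - w) * (z - starRingEnd ℂ w) / (2 * w.im * sinhDist z w ^ 3)

/-- The second derivative of the position `z` of a mass with velocity `v` that is attracted by a
mass at `w`. -/
noncomputable def accel (κ : ℝ) (z w v : ℂ) : ℂ := -(Complex.I / z.im) * v ^ 2 + κ * pull z w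

/-- `(x₁, x₂)` with velocities `v` solves Newton's equations. -/
def IsNewton (e : M ≃ᵢ ℍ) (k m₁ m₂ : ℝ) (x₁ x₂ : ℝ → M) (v : ℝ → ℂ × ℂ) : Prop :=
  ∀ t, (HasVelocity e x₁ (v t).1 t ∧ HasVelocity e x₂ (v t).2 t) ∧
    HasDerivAt (fun s => (v s).1) (accel (k * m₂) (coord e (x₁ t)) (coord e (x₂ t)) (v t).1) t ∧
    HasDerivAt (fun s => (v s).2) (accel (k * m₁) (coord e (x₂ t)) (coord e (x₁ t)) (v t).2) t

theorem pull_moveChart (e : M ≃ᵢ ℍ) (g : SL(2, ℝ)) (a b : M) :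
    pull (coord (moveChart e g) a) (coord (moveChart e g) b) =
      slDeriv g (coord e a) * pull (coord e a) (coord e b) := by
  have hs : sinhDist (coord (moveChart e g) a) (coord (moveChart e g) b) =
      sinhDist (coord e a) (coord e b) := by rw [sinhDist_coord, sinhDist_coord]
  have ha := denom_coord_ne_zero g e a
  have hb := denom_coord_ne_zero g e b
  have hy : ((coord e b).im : ℂ) ≠ 0 := by exact_mod_cast (coord_im_pos e b).ne'
  rw [pull, pull, hs, coord_moveChart, coord_moveChart, conj_mobius, mobius_sub ha hb,
    mobius_sub ha (denom_conj_ne_zero hb), im_mobius hb, slDeriv]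
  have := denom_conj_ne_zero hb
  by_cases h0 : (sinhDist (coord e a) (coord e b) : ℂ) = 0
  · simp [h0]
  field_simp

/-- The transformation law of a second derivative: the last term is `g'' v ^ 2`. It is produced by
the geodesic part of `accel`, because `denom g` at `z` and at its conjugate differ by `2 * g 1 0 * I
* z.im`; `pull` transforms as a vector. -/
theorem accel_moveChart (e : M ≃ᵢ ℍ) (g : SL(2, ℝ)) (κ : ℝ) (a b : M) (v : ℂ) :
    accel κ (coord (moveChart e g) a) (coord (moveChart e g) b) (slDeriv g (coord e a) * v) =
      slDeriv g (coord e a) * accel κ (coord e a) (coord e b) v -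
        2 * g 1 0 * v ^ 2 / denom g (coord e a) ^ 3 := by
  have ha := denom_coord_ne_zero g e a
  have ha' := denom_conj_ne_zero ha
  have hy : ((coord e a).im : ℂ) ≠ 0 := by exact_mod_cast (coord_im_pos e a).ne'
  have hden : denom g (starRingEnd ℂ (coord e a)) =
      denom g (coord e a) - 2 * g 1 0 * (Complex.I * (coord e a).im) := by
    rw [denom, denom, ofReal_im_eq]; field_simp; ring
  rw [accel, accel, pull_moveChart, coord_moveChart, im_mobius ha, slDeriv, mul_add,
    mul_left_comm (κ : ℂ)]
  rw [add_sub_right_comm]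
  congr 1
  rw [div_div_eq_mul_div, hden]
  field_simp
  linear_combination (2 * g 1 0 * ((coord e a).im : ℂ) * v ^ 2) * Complex.I_sq

theorem IsNewton.moveChart {e : M ≃ᵢ ℍ} {k m₁ m₂ : ℝ} {x₁ x₂ : ℝ → M} {v : ℝ → ℂ × ℂ}
    (h : IsNewton e k m₁ m₂ x₁ x₂ v) (g : SL(2, ℝ)) :
    IsNewton (moveChart e g) k m₁ m₂ x₁ x₂ fun t =>
      (slDeriv g (coord e (x₁ t)) * (v t).1, slDeriv g (coord e (x₂ t)) * (v t).2) := by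
  have key : ∀ (x y : ℝ → M) (u : ℝ → ℂ) (κ t : ℝ), HasVelocity e x (u t) t →
      HasDerivAt u (accel κ (coord e (x t)) (coord e (y t)) (u t)) t →
      HasDerivAt (fun s => slDeriv g (coord e (x s)) * u s)
        (accel κ (coord (HypTwoBody.moveChart e g) (x t)) (coord (HypTwoBody.moveChart e g) (y t))
          (slDeriv g (coord e (x t)) * u t)) t := by
    intro x y u κ t hx hu
    have hd := denom_coord_ne_zero g e (x t)
    have h1 := (((hasDerivAt_denom g hx).fun_pow 2).fun_inv (pow_ne_zero 2 hd)).fun_mul hu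
    rw [accel_moveChart]
    simp only [slDeriv, one_div]
    refine h1.congr_deriv ?_
    push_cast
    field_simp
    ring
  intro t
  obtain ⟨⟨h1, h2⟩, h3, h4⟩ := h t
  exact ⟨⟨h1.moveChart g, h2.moveChart g⟩, key _ _ _ _ t h1 h3, key _ _ _ _ t h2 h4⟩

/-! ### The Euler-Lagrange equations in Newton's form -/

/-- The linear functional on pairs of tangent vectors with Euclidean gradient `p`. -/
noncomputable def covector : ℂ × ℂ →L[ℝ] ℂ × ℂ →L[ℝ] ℝ :=
  LinearMap.toContinuousLinearMap
    { toFun := fun p =>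
        (p.1.re • Complex.reCLM + p.1.im • Complex.imCLM).comp (ContinuousLinearMap.fst ℝ ℂ ℂ) +
        (p.2.re • Complex.reCLM + p.2.im • Complex.imCLM).comp (ContinuousLinearMap.snd ℝ ℂ ℂ)
      map_add' := fun p q => by ext <;> simp <;> ring
      map_smul' := fun c p => by ext <;> simp <;> ring }

theorem covector_apply (p w : ℂ × ℂ) : covector p w =
    p.1.re * w.1.re + p.1.im * w.1.im + (p.2.re * w.2.re + p.2.im * w.2.im) := rfl

theorem hasDerivAt_of_re_im {f : ℝ → ℂ} {f' : ℂ} {t : ℝ}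
    (h₁ : HasDerivAt (fun s => (f s).re) f'.re t) (h₂ : HasDerivAt (fun s => (f s).im) f'.im t) :
    HasDerivAt f f' t := by
  have := h₁.ofReal_comp.add (h₂.ofReal_comp.mul_const Complex.I)
  rw [Complex.re_add_im] at this
  refine this.congr_of_eventuallyEq (Filter.Eventually.of_forall fun s => ?_)
  exact (Complex.re_add_im (f s)).symm

theorem hasDerivAt_im {f : ℝ → ℂ} {f' : ℂ} {t : ℝ} (h : HasDerivAt f f' t) :
    HasDerivAt (fun s => (f s).im) f'.im t :=
  Complex.imCLM.hasFDerivAt.comp_hasDerivAt t h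

/-- Evaluation on the four real basis vectors recovers the gradient. The Euler-Lagrange equation
between functionals thus becomes a pair of complex equations. -/
theorem hasDerivAt_covector_iff {p : ℝ → ℂ × ℂ} {p' : ℂ × ℂ} {t : ℝ} :
    HasDerivAt (fun s => covector (p s)) (covector p') t ↔
      HasDerivAt (fun s => (p s).1) p'.1 t ∧ HasDerivAt (fun s => (p s).2) p'.2 t := by
  constructor
  · intro h
    have key : ∀ w : ℂ × ℂ, HasDerivAt (fun s => covector (p s) w) (covector p' w) t := fun w => by
      simpa using h.clm_apply (hasDerivAt_const t w)
    constructor <;> apply hasDerivAt_of_re_im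
    · simpa [covector_apply] using key (1, 0)
    · simpa [covector_apply] using key (Complex.I, 0)
    · simpa [covector_apply] using key (0, 1)
    · simpa [covector_apply] using key (0, Complex.I)
  · rintro ⟨h1, h2⟩
    exact covector.hasFDerivAt.comp_hasDerivAt t (h1.prodMk h2)

theorem hasFDerivAt_fst_re (q : ℂ × ℂ) : HasFDerivAt (fun q : ℂ × ℂ => q.1.re) (covector (1, 0)) q := by
  refine (Complex.reCLM.comp (ContinuousLinearMap.fst ℝ ℂ ℂ)).hasFDerivAt.congr_fderiv ?_
  ext w <;> simp [covector_apply]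

theorem hasFDerivAt_fst_im (q : ℂ × ℂ) :
    HasFDerivAt (fun q : ℂ × ℂ => q.1.im) (covector (Complex.I, 0)) q := by
  refine (Complex.imCLM.comp (ContinuousLinearMap.fst ℝ ℂ ℂ)).hasFDerivAt.congr_fderiv ?_
  ext w <;> simp [covector_apply]

theorem hasFDerivAt_snd_re (q : ℂ × ℂ) : HasFDerivAt (fun q : ℂ × ℂ => q.2.re) (covector (0, 1)) q := by
  refine (Complex.reCLM.comp (ContinuousLinearMap.snd ℝ ℂ ℂ)).hasFDerivAt.congr_fderiv ?_
  ext w <;> simp [covector_apply]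

theorem hasFDerivAt_snd_im (q : ℂ × ℂ) :
    HasFDerivAt (fun q : ℂ × ℂ => q.2.im) (covector (0, Complex.I)) q := by
  refine (Complex.imCLM.comp (ContinuousLinearMap.snd ℝ ℂ ℂ)).hasFDerivAt.congr_fderiv ?_
  ext w <;> simp [covector_apply]

theorem fderiv_lagrangian_velocity (k m₁ m₂ : ℝ) (q v : ℂ × ℂ) :
    fderiv ℝ (fun w => lagrangian k m₁ m₂ q w) v =
      covector ((m₁ / q.1.im ^ 2) • v.1, (m₂ / q.2.im ^ 2) • v.2) := by
  apply HasFDerivAt.fderiv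
  have h1 := hasFDerivAt_fst_re v
  have h2 := hasFDerivAt_fst_im v
  have h3 := hasFDerivAt_snd_re v
  have h4 := hasFDerivAt_snd_im v
  have := (((((h1.mul h1).add (h2.mul h2)).mul_const (q.1.im ^ 2)⁻¹).const_mul m₁).add
    ((((h3.mul h3).add (h4.mul h4)).mul_const (q.2.im ^ 2)⁻¹).const_mul m₂)).mul_const (2⁻¹ : ℝ)
    |>.sub_const (potential k m₁ m₂
      (dist (UpperHalfPlane.ofComplex q.1) (UpperHalfPlane.ofComplex q.2)))
  refine (this.congr_fderiv ?_).congr_of_eventuallyEq (Filter.Eventually.of_forall fun w => ?_)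
  · simp only [← map_smul, ← map_add]
    congr 1
    apply Prod.ext <;> apply Complex.ext <;>
      simp [-Complex.real_smul, Complex.smul_re, Complex.smul_im] <;> ring
  · simp [lagrangian, hypInner, div_eq_mul_inv]

theorem hasFDerivAt_coshDist {q : ℂ × ℂ} (h₁ : q.1.im ≠ 0) (h₂ : q.2.im ≠ 0) :
    HasFDerivAt (fun q : ℂ × ℂ => coshDist q.1 q.2)
      (covector
        ((1 / (2 * q.1.im ^ 2 * q.2.im)) • (-Complex.I * (q.1 - q.2) * (q.1 - starRingEnd ℂ q.2)),
        (1 / (2 * q.2.im ^ 2 * q.1.im)) • (-Complex.I * (q.2 - q.1) * (q.2 - starRingEnd ℂ q.1)))) q := by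
  have a1 := hasFDerivAt_fst_re q
  have a2 := hasFDerivAt_fst_im q
  have a3 := hasFDerivAt_snd_re q
  have a4 := hasFDerivAt_snd_im q
  have b1 := ((a1.sub a3).mul (a1.sub a3)).add ((a2.sub a4).mul (a2.sub a4))
  have b2 := (hasDerivAt_inv (mul_ne_zero h₁ h₂)).comp_hasFDerivAt q (a2.mul a4)
  have := ((b1.mul b2).const_mul (2⁻¹ : ℝ)).const_add 1
  refine (this.congr_fderiv ?_).congr_of_eventuallyEq (Filter.Eventually.of_forall fun w => ?_)
  · simp only [← map_smul, ← map_add, ← map_sub]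
    congr 1
    apply Prod.ext <;> apply Complex.ext <;>
      simp [-Complex.real_smul, Complex.smul_re, Complex.smul_im] <;> field_simp <;> ring
  · simp [coshDist, div_eq_mul_inv]; ring

/-- Here `c` stands for `cosh d`, a rational function of the coordinates. The derivative `-1 / sinh
d ^ 3` is the source of the cube in `pull`. -/
theorem hasDerivAt_coth {c : ℝ} (hc : 1 < c) :
    HasDerivAt (fun c => c / Real.sqrt (c ^ 2 - 1)) (-1 / Real.sqrt (c ^ 2 - 1) ^ 3) c := by
  have h0 : 0 < c ^ 2 - 1 := by nlinarith
  have hs := Real.sqrt_pos.2 h0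
  have hs2 := Real.sq_sqrt h0.le
  have h1 : HasDerivAt (fun c : ℝ => c ^ 2 - 1) (2 * c) c := by
    simpa using (hasDerivAt_pow 2 c).sub_const 1
  refine ((hasDerivAt_id c).fun_div (h1.sqrt h0.ne') hs.ne').congr_deriv ?_
  simp only [id]
  field_simp
  linear_combination hs2

theorem lagrangian_coe (k m₁ m₂ : ℝ) {q : ℂ × ℂ} (h₁ : 0 < q.1.im) (h₂ : 0 < q.2.im) (v : ℂ × ℂ) :
    lagrangian k m₁ m₂ q v =
      (m₁ * hypInner q.1 v.1 v.1 + m₂ * hypInner q.2 v.2 v.2) / 2 +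
      k * m₁ * m₂ * (coshDist q.1 q.2 / Real.sqrt (coshDist q.1 q.2 ^ 2 - 1)) := by
  have hc := coshDist_coe ⟨q.1, h₁⟩ ⟨q.2, h₂⟩
  have hs := sinhDist_coe ⟨q.1, h₁⟩ ⟨q.2, h₂⟩
  rw [sinhDist] at hs
  rw [lagrangian, potential, UpperHalfPlane.ofComplex_apply_of_im_pos h₁,
    UpperHalfPlane.ofComplex_apply_of_im_pos h₂, sub_neg_eq_add, ← hc, ← hs]

theorem fderiv_lagrangian_position (k m₁ m₂ : ℝ) {q : ℂ × ℂ} (h₁ : 0 < q.1.im) (h₂ : 0 < q.2.im)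
    (h : 1 < coshDist q.1 q.2) (v : ℂ × ℂ) :
    fderiv ℝ (fun q => lagrangian k m₁ m₂ q v) q = covector
      (-(m₁ * Complex.normSq v.1 / q.1.im ^ 3) • Complex.I +
        (k * m₁ * m₂ / q.1.im ^ 2) • pull q.1 q.2,
      -(m₂ * Complex.normSq v.2 / q.2.im ^ 3) • Complex.I +
        (k * m₁ * m₂ / q.2.im ^ 2) • pull q.2 q.1) := by
  apply HasFDerivAt.fderiv
  have hpow : ∀ {y : ℝ}, y ≠ 0 → HasDerivAt (fun y : ℝ => (y ^ 2)⁻¹) (-2 / y ^ 3) y := fun {y} hy => by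
    refine ((hasDerivAt_pow 2 y).fun_inv (pow_ne_zero 2 hy)).congr_deriv ?_
    field_simp; push_cast; simp [mul_comm]
  have a2 := ((hpow h₁.ne').comp_hasFDerivAt q (hasFDerivAt_fst_im q)).const_mul
    (m₁ * Complex.normSq v.1)
  have a4 := ((hpow h₂.ne').comp_hasFDerivAt q (hasFDerivAt_snd_im q)).const_mul
    (m₂ * Complex.normSq v.2)
  have a5 := ((hasDerivAt_coth h).comp_hasFDerivAt q
    (hasFDerivAt_coshDist h₁.ne' h₂.ne')).const_mul (k * m₁ * m₂)
  have := ((a2.add a4).mul_const (2⁻¹ : ℝ)).add a5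
  refine (this.congr_fderiv ?_).congr_of_eventuallyEq ?_
  · have hp : ∀ {z w : ℂ}, z.im ≠ 0 → (k * m₁ * m₂ / z.im ^ 2) • pull z w =
        (k * m₁ * m₂) • (-1 / sinhDist z w ^ 3) • (1 / (2 * z.im ^ 2 * w.im)) •
          (-Complex.I * (z - w) * (z - starRingEnd ℂ w)) := by
      intro z w hz
      rw [pull]
      simp only [Complex.real_smul]
      push_cast
      have hz : (z.im : ℂ) ≠ 0 := by exact_mod_cast hz
      by_cases h0 : (sinhDist z w : ℂ) = 0
      · simp [h0]
      by_cases h0 : (w.im : ℂ) = 0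
      · simp [h0]
      field_simp
    rw [hp h₁.ne', hp h₂.ne', sinhDist, sinhDist, coshDist_comm q.2]
    simp only [← map_smul, ← map_add]
    congr 1
    apply Prod.ext
    · simp only [Prod.fst_add, Prod.smul_fst, add_zero, smul_zero, smul_smul]
      congr 2 <;> ring
    · simp only [Prod.snd_add, Prod.smul_snd, zero_add, smul_zero, smul_smul]
      congr 2 <;> ring
  -- The explicit formula for the Lagrangian is available where both imaginary parts are positive,
  -- an open condition.
  · have o1 : ∀ᶠ q' : ℂ × ℂ in nhds q, 0 < q'.1.im :=
      (Complex.continuous_im.comp continuous_fst).continuousAt.eventually (lt_mem_nhds h₁)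
    have o2 : ∀ᶠ q' : ℂ × ℂ in nhds q, 0 < q'.2.im :=
      (Complex.continuous_im.comp continuous_snd).continuousAt.eventually (lt_mem_nhds h₂)
    filter_upwards [o1, o2] with q' h1 h2
    rw [lagrangian_coe k m₁ m₂ h1 h2]
    simp [hypInner, Complex.normSq_apply, div_eq_mul_inv]
    ring

/-- The velocity is not assumed differentiable. From left to right, its derivative is obtained by
multiplying the momentum by the differentiable factor `z.im ^ 2 / m`. -/
theorem hasDerivAt_momentum_iff {m κ : ℝ} (hm : m ≠ 0) {z v : ℝ → ℂ} {w : ℂ} {t : ℝ}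
    (hy : (z t).im ≠ 0) (hz : HasDerivAt z (v t) t) :
    HasDerivAt (fun s => (m / (z s).im ^ 2) • v s)
      (-(m * Complex.normSq (v t) / (z t).im ^ 3) • Complex.I +
        (m * κ / (z t).im ^ 2) • pull (z t) w) t ↔
    HasDerivAt v (accel κ (z t) w (v t)) t := by
  have him := hasDerivAt_im hz
  have hyc : ((z t).im : ℂ) ≠ 0 := by exact_mod_cast hy
  have hmc : (m : ℂ) ≠ 0 := by exact_mod_cast hm
  -- This identity merges the derivative of the conformal factor and the position derivative of the
  -- kinetic energy into the holomorphic term `-(I / z.im) * v ^ 2`.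
  have key : (Complex.normSq (v t) : ℂ) * Complex.I = Complex.I * v t ^ 2 + 2 * (v t).im * v t := by
    rw [← Complex.mul_conj]
    have := Complex.sub_conj (v t)
    push_cast at this
    linear_combination (-Complex.I * v t) * this -
      (2 * (v t).im * v t) * Complex.I_sq
  constructor
  · intro h
    have h1 : HasDerivAt (fun s => (z s).im ^ 2 / m) (2 * (z t).im * (v t).im / m) t := by
      simpa using (him.fun_pow 2).div_const m
    have h2 := h1.fun_smul h
    refine (h2.congr_deriv ?_).congr_of_eventuallyEq ?_
    · simp only [Complex.real_smul, accel]
      push_cast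
      field_simp
      linear_combination -key
    · filter_upwards [him.continuousAt.eventually_ne hy] with s hs
      rw [smul_smul]
      field_simp
      simp
  · intro h
    have h1 : HasDerivAt (fun s => m / (z s).im ^ 2) (-(2 * m * (v t).im / (z t).im ^ 3)) t := by
      refine ((hasDerivAt_const t m).fun_div (him.fun_pow 2) (pow_ne_zero 2 hy)).congr_deriv ?_
      field_simp
      push_cast
      ring
    refine (h1.fun_smul h).congr_deriv ?_
    simp only [Complex.real_smul, accel]
    push_cast
    field_simp
    linear_combination key

theorem eulerLagrange_iff {k m₁ m₂ : ℝ} (hm₁ : 0 < m₁) (hm₂ : 0 < m₂) {z₁ z₂ : ℝ → ℂ}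
    {v : ℝ → ℂ × ℂ} {t : ℝ} (hv₁ : HasDerivAt z₁ (v t).1 t) (hv₂ : HasDerivAt z₂ (v t).2 t)
    (h₁ : 0 < (z₁ t).im) (h₂ : 0 < (z₂ t).im) (h : 1 < coshDist (z₁ t) (z₂ t)) :
    HasDerivAt (fun s => fderiv ℝ (fun w => lagrangian k m₁ m₂ (z₁ s, z₂ s) w) (v s))
      (fderiv ℝ (fun q => lagrangian k m₁ m₂ q (v t)) (z₁ t, z₂ t)) t ↔
    HasDerivAt (fun s => (v s).1) (accel (k * m₂) (z₁ t) (z₂ t) (v t).1) t ∧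
    HasDerivAt (fun s => (v s).2) (accel (k * m₁) (z₂ t) (z₁ t) (v t).2) t := by
  have e1 := hasDerivAt_momentum_iff (κ := k * m₂) (w := z₂ t) (v := fun s => (v s).1)
    hm₁.ne' h₁.ne' hv₁
  have e2 := hasDerivAt_momentum_iff (κ := k * m₁) (w := z₁ t) (v := fun s => (v s).2)
    hm₂.ne' h₂.ne' hv₂
  rw [show m₁ * (k * m₂) = k * m₁ * m₂ by ring] at e1
  rw [show m₂ * (k * m₁) = k * m₁ * m₂ by ring] at e2
  have hf : (fun s => fderiv ℝ (fun w => lagrangian k m₁ m₂ (z₁ s, z₂ s) w) (v s)) = fun s =>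
      covector ((m₁ / (z₁ s).im ^ 2) • (v s).1, (m₂ / (z₂ s).im ^ 2) • (v s).2) :=
    funext fun s => fderiv_lagrangian_velocity k m₁ m₂ _ _
  rw [hf, fderiv_lagrangian_position k m₁ m₂ (q := (z₁ t, z₂ t)) h₁ h₂ h, hasDerivAt_covector_iff]
  exact and_congr e1 e2

theorem isMotion_iff {e : M ≃ᵢ ℍ} {k m₁ m₂ : ℝ} (hm₁ : 0 < m₁) (hm₂ : 0 < m₂) {x₁ x₂ : ℝ → M} :
    IsMotion e k m₁ m₂ x₁ x₂ ↔ (∀ t, x₁ t ≠ x₂ t) ∧ ∃ v, IsNewton e k m₁ m₂ x₁ x₂ v := by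
  constructor
  · rintro ⟨hx, v, hv, h⟩
    exact ⟨hx, v, fun t => ⟨hv t, (eulerLagrange_iff hm₁ hm₂ (hv t).1 (hv t).2 (coord_im_pos e _)
      (coord_im_pos e _) (one_lt_coshDist e (hx t))).1 (h t)⟩⟩
  · rintro ⟨hx, v, h⟩
    exact ⟨hx, v, fun t => (h t).1, fun t => (eulerLagrange_iff hm₁ hm₂ (h t).1.1 (h t).1.2
      (coord_im_pos e _) (coord_im_pos e _) (one_lt_coshDist e (hx t))).2 (h t).2⟩

theorem IsMotion.moveChart {e : M ≃ᵢ ℍ} {k m₁ m₂ : ℝ} (hm₁ : 0 < m₁) (hm₂ : 0 < m₂)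
    {x₁ x₂ : ℝ → M} (h : IsMotion e k m₁ m₂ x₁ x₂) (g : SL(2, ℝ)) :
    IsMotion (moveChart e g) k m₁ m₂ x₁ x₂ := by
  rw [isMotion_iff hm₁ hm₂] at h ⊢
  exact ⟨h.1, h.2.elim fun v hv => ⟨_, hv.moveChart g⟩⟩

/-! ### Uniqueness of solutions -/

/-- The set of times of agreement is closed, and open by local uniqueness; `ℝ` is connected.
Smoothness along `f` alone suffices, since `g` is near `f` close to a time of agreement. -/
theorem autonomous_ode_unique {E : Type*} [NormedAddCommGroup E] [NormedSpace ℝ E] {F : E → E}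
    {f g : ℝ → E} (hf : ∀ t, HasDerivAt f (F (f t)) t) (hg : ∀ t, HasDerivAt g (F (g t)) t)
    (hF : ∀ t, ContDiffAt ℝ 1 F (f t)) (h0 : f 0 = g 0) : f = g := by
  have hfc : Continuous f := continuous_iff_continuousAt.2 fun t => (hf t).continuousAt
  have hgc : Continuous g := continuous_iff_continuousAt.2 fun t => (hg t).continuousAt
  have hclopen : IsClopen {t | f t = g t} := by
    refine ⟨isClosed_eq hfc hgc, isOpen_iff_mem_nhds.2 fun t ht => ?_⟩
    obtain ⟨K, s, hs, hK⟩ := (hF t).exists_lipschitzOnWith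
    have ht : f t = g t := ht
    exact ODE_solution_unique_of_eventually (v := fun _ => F) (s := fun _ => s)
      (Filter.Eventually.of_forall fun _ => hK)
      ((hfc.continuousAt.eventually hs).mono fun τ hτ => ⟨hf τ, hτ⟩)
      ((hgc.continuousAt.eventually (ht ▸ hs)).mono fun τ hτ => ⟨hg τ, hτ⟩) ht
  have := hclopen.eq_univ ⟨0, h0⟩
  exact funext fun t => (Set.eq_univ_iff_forall.1 this) t

theorem contDiffAt_im {E : Type*} [NormedAddCommGroup E] [NormedSpace ℝ E] {f : E → ℂ} {a : E}
    (hf : ContDiffAt ℝ 1 f a) : ContDiffAt ℝ 1 (fun x => (f x).im) a :=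
  Complex.imCLM.contDiff.contDiffAt.comp a hf

theorem contDiffAt_re {E : Type*} [NormedAddCommGroup E] [NormedSpace ℝ E] {f : E → ℂ} {a : E}
    (hf : ContDiffAt ℝ 1 f a) : ContDiffAt ℝ 1 (fun x => (f x).re) a :=
  Complex.reCLM.contDiff.contDiffAt.comp a hf

theorem contDiffAt_ofReal {E : Type*} [NormedAddCommGroup E] [NormedSpace ℝ E] {f : E → ℝ} {a : E}
    (hf : ContDiffAt ℝ 1 f a) : ContDiffAt ℝ 1 (fun x => (f x : ℂ)) a :=
  Complex.ofRealCLM.contDiff.contDiffAt.comp a hf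

theorem contDiffAt_complex_div {E : Type*} [NormedAddCommGroup E] [NormedSpace ℝ E] {f g : E → ℂ}
    {a : E} (hf : ContDiffAt ℝ 1 f a) (hg : ContDiffAt ℝ 1 g a) (h : g a ≠ 0) :
    ContDiffAt ℝ 1 (fun x => f x / g x) a := by
  simp only [div_eq_mul_inv]
  exact hf.mul (hg.inv h)

theorem contDiffAt_accel {E : Type*} [NormedAddCommGroup E] [NormedSpace ℝ E] {z w v : E → ℂ} {a : E}
    (κ : ℝ) (hz : ContDiffAt ℝ 1 z a) (hw : ContDiffAt ℝ 1 w a) (hv : ContDiffAt ℝ 1 v a)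
    (h₁ : (z a).im ≠ 0) (h₂ : (w a).im ≠ 0) (h : 1 < coshDist (z a) (w a)) :
    ContDiffAt ℝ 1 (fun x => accel κ (z x) (w x) (v x)) a := by
  have hzi := contDiffAt_im hz
  have hwi := contDiffAt_im hw
  have hC : ContDiffAt ℝ 1 (fun x => coshDist (z x) (w x)) a := by
    refine contDiffAt_const.add (ContDiffAt.div ?_ ((contDiffAt_const.mul hzi).mul hwi) ?_)
    · exact (((contDiffAt_re hz).sub (contDiffAt_re hw)).pow 2).add ((hzi.sub hwi).pow 2)
    · exact mul_ne_zero (mul_ne_zero two_ne_zero h₁) h₂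
  have hpos : 0 < coshDist (z a) (w a) ^ 2 - 1 := by nlinarith
  have hS : ContDiffAt ℝ 1 (fun x => sinhDist (z x) (w x)) a :=
    ((hC.pow 2).sub contDiffAt_const).sqrt hpos.ne'
  have hS0 : sinhDist (z a) (w a) ≠ 0 := (Real.sqrt_pos.2 hpos).ne'
  have hconj : ContDiffAt ℝ 1 (fun x => starRingEnd ℂ (w x)) a :=
    Complex.conjCLE.contDiff.contDiffAt.comp a hw
  have hpull : ContDiffAt ℝ 1 (fun x => pull (z x) (w x)) a := by
    refine contDiffAt_complex_div ((contDiffAt_const.mul (hz.sub hw)).mul (hz.sub hconj))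
      ((contDiffAt_const.mul (contDiffAt_ofReal hwi)).mul ((contDiffAt_ofReal hS).pow 3)) ?_
    have h3 : ((w a).im : ℂ) ≠ 0 := by exact_mod_cast h₂
    have h4 : (sinhDist (z a) (w a) : ℂ) ≠ 0 := by exact_mod_cast hS0
    exact mul_ne_zero (mul_ne_zero two_ne_zero h3) (pow_ne_zero 3 h4)
  have h3 : ((z a).im : ℂ) ≠ 0 := by exact_mod_cast h₁
  exact ((contDiffAt_complex_div contDiffAt_const (contDiffAt_ofReal hzi) h3).neg.mul (hv.pow 2)).add
    (contDiffAt_const.mul hpull)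

/-- The vector field of Newton's equations on the space of positions and velocities. -/
noncomputable def newtonField (k m₁ m₂ : ℝ) (y : (ℂ × ℂ) × ℂ × ℂ) : (ℂ × ℂ) × ℂ × ℂ :=
  (y.2, (accel (k * m₂) y.1.1 y.1.2 y.2.1, accel (k * m₁) y.1.2 y.1.1 y.2.2))

theorem contDiffAt_newtonField (k m₁ m₂ : ℝ) {y : (ℂ × ℂ) × ℂ × ℂ} (h₁ : y.1.1.im ≠ 0)
    (h₂ : y.1.2.im ≠ 0) (h : 1 < coshDist y.1.1 y.1.2) :
    ContDiffAt ℝ 1 (newtonField k m₁ m₂) y := by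
  refine contDiffAt_snd.prodMk (ContDiffAt.prodMk ?_ ?_)
  · exact contDiffAt_accel _ contDiffAt_fst.fst contDiffAt_fst.snd contDiffAt_snd.fst h₁ h₂ h
  · rw [coshDist_comm] at h
    exact contDiffAt_accel _ contDiffAt_fst.snd contDiffAt_fst.fst contDiffAt_snd.snd h₂ h₁ h

theorem IsNewton.hasDerivAt {e : M ≃ᵢ ℍ} {k m₁ m₂ : ℝ} {x₁ x₂ : ℝ → M} {v : ℝ → ℂ × ℂ}
    (h : IsNewton e k m₁ m₂ x₁ x₂ v) (t : ℝ) :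
    HasDerivAt (fun t => ((coord e (x₁ t), coord e (x₂ t)), ((v t).1, (v t).2)))
      (newtonField k m₁ m₂ ((coord e (x₁ t), coord e (x₂ t)), ((v t).1, (v t).2))) t :=
  ((h t).1.1.prodMk (h t).1.2).prodMk ((h t).2.1.prodMk (h t).2.2)

theorem coord_injective (e : M ≃ᵢ ℍ) : Function.Injective (coord e) := fun _ _ h =>
  e.injective (UpperHalfPlane.ext h)

theorem IsMotion.unique {e : M ≃ᵢ ℍ} {k m₁ m₂ : ℝ} (hm₁ : 0 < m₁) (hm₂ : 0 < m₂)
    {x₁ x₂ y₁ y₂ : ℝ → M} (hx : IsMotion e k m₁ m₂ x₁ x₂) (hy : IsMotion e k m₁ m₂ y₁ y₂)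
    {u₁ u₂ : ℂ} (h₁ : y₁ 0 = x₁ 0) (h₂ : y₂ 0 = x₂ 0)
    (hx₁ : HasVelocity e x₁ u₁ 0) (hx₂ : HasVelocity e x₂ u₂ 0)
    (hy₁ : HasVelocity e y₁ u₁ 0) (hy₂ : HasVelocity e y₂ u₂ 0) : y₁ = x₁ ∧ y₂ = x₂ := by
  rw [isMotion_iff hm₁ hm₂] at hx hy
  obtain ⟨hx, v, hv⟩ := hx
  obtain ⟨-, w, hw⟩ := hy
  have := autonomous_ode_unique hv.hasDerivAt hw.hasDerivAt
    (fun t => contDiffAt_newtonField k m₁ m₂ (coord_im_pos e _).ne' (coord_im_pos e _).ne'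
      (one_lt_coshDist e (hx t))) (by
    rw [h₁, h₂, HasDerivAt.unique (hv 0).1.1 hx₁, HasDerivAt.unique (hv 0).1.2 hx₂,
      HasDerivAt.unique (hw 0).1.1 hy₁, HasDerivAt.unique (hw 0).1.2 hy₂])
  have key := fun t => congrFun this t
  simp only [Prod.mk.injEq] at key
  exact ⟨funext fun t => coord_injective e (key t).1.1.symm,
    funext fun t => coord_injective e (key t).1.2.symm⟩

/-! ### Calculus in Fermi coordinates -/

theorem normSq_fermi (s t : ℝ) : Complex.normSq (fermi s t) = Real.exp t ^ 2 := by
  have h := Real.cosh_pos s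
  rw [Complex.normSq_apply, fermi_re, fermi_im]
  field_simp
  linear_combination -Real.cosh_sq s

theorem fermi_add (s t τ : ℝ) : (fermi s (t + τ) : ℂ) = Real.exp τ * fermi s t := by
  rw [← translation_smul_fermi, translation_smul]

theorem hasDerivAt_fermi_right (s τ ω t : ℝ) :
    HasDerivAt (fun t => (fermi s (τ + ω * t) : ℂ)) (ω * fermi s (τ + ω * t)) t := by
  simp only [fermi_add]
  have h : HasDerivAt (fun t => Real.exp (ω * t)) (Real.exp (ω * t) * ω) t := by
    simpa using ((hasDerivAt_id t).const_mul ω).exp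
  refine (h.ofReal_comp.mul_const _).congr_deriv ?_
  push_cast
  ring

/-- The factor `-I` makes the transversal geodesics perpendicular to the translation orbits, whose
velocities are real multiples of the position. -/
theorem hasDerivAt_fermi_left (s t : ℝ) :
    HasDerivAt (fun s => (fermi s t : ℂ)) (((1 / Real.cosh s : ℝ) : ℂ) * (-Complex.I * fermi s t)) s := by
  have hc := (Real.cosh_pos s).ne'
  have hs := Real.cosh_sq s
  apply hasDerivAt_of_re_im
  · simp only [fermi_re]
    refine (((Real.hasDerivAt_sinh s).div (Real.hasDerivAt_cosh s) hc).const_mul _).congr_deriv ?_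
    rw [Complex.re_ofReal_mul]
    simp [im_fermi]
    field_simp
    linear_combination hs
  · simp only [fermi_im]
    refine (((hasDerivAt_const s (1 : ℝ)).div (Real.hasDerivAt_cosh s) hc).const_mul _).congr_deriv ?_
    rw [Complex.im_ofReal_mul]
    simp [re_fermi]
    field_simp

theorem hasVelocity_orbit {e : M ≃ᵢ ℍ} {x : ℝ → M} {s τ ω : ℝ}
    (hx : ∀ t, e (x t) = fermi s (τ + ω * t)) (t : ℝ) : HasVelocity e x (ω * coord e (x t)) t := by
  simp only [HasVelocity, coord, hx]
  exact hasDerivAt_fermi_right s τ ω t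

theorem hypNorm_fermi {e : M ≃ᵢ ℍ} {a : M} {s t : ℝ} (h : e a = fermi s t) (ω : ℝ) :
    hypNorm (coord e a) (ω * coord e a) = |ω| * Real.cosh s := by
  have hc := Real.cosh_pos s
  have he := Real.exp_pos t
  have hn := normSq_fermi s t
  rw [Complex.normSq_apply] at hn
  rw [hypNorm, hypInner, coord, h, Complex.re_ofReal_mul, Complex.im_ofReal_mul,
    show ω * (fermi s t : ℂ).re * (ω * (fermi s t : ℂ).re) +
      ω * (fermi s t : ℂ).im * (ω * (fermi s t : ℂ).im) = ω ^ 2 * Real.exp t ^ 2 by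
      linear_combination ω ^ 2 * hn, fermi_im]
  rw [Real.sqrt_eq_iff_mul_self_eq (by positivity) (by positivity)]
  field_simp
  rw [sq_abs]

theorem perpEquallyOriented_fermi {e : M ≃ᵢ ℍ} {a₁ a₂ : M} {s₁ s₂ τ ω : ℝ} (hω : ω ≠ 0)
    (h₁ : e a₁ = fermi s₁ τ) (h₂ : e a₂ = fermi s₂ τ) :
    PerpEquallyOriented e (fun s => e.symm (fermi s τ)) a₁ a₂ (ω * coord e a₁) (ω * coord e a₂) := by
  have hv : ∀ s, HasVelocity e (fun s => e.symm (fermi s τ))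
      (((1 / Real.cosh s : ℝ) : ℂ) * (-Complex.I * fermi s τ)) s := fun s => by
    simp only [HasVelocity, coord, e.apply_symm_apply]
    exact hasDerivAt_fermi_left s τ
  have ho : ∀ s, orient (ω * fermi s τ) (((1 / Real.cosh s : ℝ) : ℂ) * (-Complex.I * fermi s τ)) =
      -ω * (1 / Real.cosh s * Complex.normSq (fermi s τ)) := fun s => by
    rw [orient, Complex.normSq_apply]
    simp only [Complex.re_ofReal_mul, Complex.im_ofReal_mul]
    simp
    ring
  have hp : ∀ s, hypInner (fermi s τ) (ω * fermi s τ)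
      (((1 / Real.cosh s : ℝ) : ℂ) * (-Complex.I * fermi s τ)) = 0 := fun s => by
    rw [hypInner]
    simp only [Complex.re_ofReal_mul, Complex.im_ofReal_mul]
    simp
    ring_nf
    simp
  refine ⟨isGeodesic_fermi_left e τ, s₁, s₂, _, _, ?_, ?_, hv s₁, hv s₂, ?_, ?_, ?_⟩
  · exact (congrArg e.symm h₁.symm).trans (e.symm_apply_apply _)
  · exact (congrArg e.symm h₂.symm).trans (e.symm_apply_apply _)
  · rw [coord, h₁, hp]
  · rw [coord, h₂, hp]
  · rw [coord, coord, h₁, h₂, ho, ho, mul_mul_mul_comm, neg_mul_neg, normSq_fermi, normSq_fermi]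
    have := Real.cosh_pos s₁
    have := Real.cosh_pos s₂
    have := mul_self_pos.2 hω
    positivity

theorem perpAt_fermi {e : M ≃ᵢ ℍ} {c : M} {τ : ℝ} (h : e c = fermi 0 τ) :
    PerpAt e (fun s => e.symm (fermi s τ)) (fun t => e.symm (fermi 0 t)) c := by
  have hc := (congrArg e.symm h.symm).trans (e.symm_apply_apply _)
  refine ⟨0, τ, ((1 / Real.cosh 0 : ℝ) : ℂ) * (-Complex.I * fermi 0 τ), fermi 0 τ, hc, hc,
    ?_, ?_, ?_⟩
  · simp only [HasVelocity, coord, e.apply_symm_apply]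
    exact hasDerivAt_fermi_left 0 τ
  · simp only [HasVelocity, coord, e.apply_symm_apply]
    simpa using hasDerivAt_fermi_right 0 0 1 τ
  · rw [hypInner]
    simp only [Complex.re_ofReal_mul, Complex.im_ofReal_mul]
    simp [re_fermi]

/-! ### Newton's equations for orbits of translations -/

/-- After clearing denominators the left side is a real multiple of `z`, and the attraction is a
real multiple of `z ^ 2 - 2 * z * w.re + normSq w`. The imaginary part of the equation is the scalar
balance; given it, the real part amounts to equal moduli. -/
theorem accel_orbit_iff {z w : ℂ} {κ ω : ℝ} (hκ : κ ≠ 0) (hz : 0 < z.im) (hw : 0 < w.im)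
    (hS : 0 < sinhDist z w) :
    (ω : ℂ) ^ 2 * z = accel κ z w (ω * z) ↔ Complex.normSq z = Complex.normSq w ∧
      ω ^ 2 * z.re * (w.im * sinhDist z w ^ 3) = κ * (z.re - w.re) * z.im := by
  have hzc : (z.im : ℂ) ≠ 0 := by exact_mod_cast hz.ne'
  have hwc : (w.im : ℂ) ≠ 0 := by exact_mod_cast hw.ne'
  have hSc : (sinhDist z w : ℂ) ≠ 0 := by exact_mod_cast hS.ne'
  have h1 : (ω : ℂ) ^ 2 * z = accel κ z w (ω * z) ↔
      2 * (ω : ℂ) ^ 2 * z * z.re * (w.im * sinhDist z w ^ 3) =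
        κ * (z - w) * (z - starRingEnd ℂ w) * z.im := by
    rw [accel, pull]
    have hre : (z.im : ℂ) + Complex.I * z = Complex.I * z.re := by
      linear_combination (z.im : ℂ) * Complex.I_sq - Complex.I * Complex.re_add_im z
    constructor
    · intro h
      field_simp at h
      apply mul_left_cancel₀ Complex.I_ne_zero
      linear_combination h - 2 * (ω : ℂ) ^ 2 * z * (w.im * sinhDist z w ^ 3) * hre
    · intro h
      field_simp
      linear_combination Complex.I * h + 2 * (ω : ℂ) ^ 2 * z * (w.im * sinhDist z w ^ 3) * hre
  rw [h1]
  generalize sinhDist z w = S at *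
  have h2 : (z - w) * (z - starRingEnd ℂ w) = z ^ 2 - 2 * z * w.re + Complex.normSq w := by
    rw [← Complex.mul_conj]
    have := Complex.add_conj w
    push_cast at this
    linear_combination (-z) * this
  have hL : 2 * (ω : ℂ) ^ 2 * z * z.re * (w.im * S ^ 3) =
      ((2 * ω ^ 2 * z.re * (w.im * S ^ 3) : ℝ) : ℂ) * z := by push_cast; ring
  have hR : (κ : ℂ) * (z ^ 2 - 2 * z * w.re + Complex.normSq w) * z.im =
      ((κ * z.im : ℝ) : ℂ) * (z ^ 2 - ((2 * w.re : ℝ) : ℂ) * z + Complex.normSq w) := by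
    push_cast; ring
  rw [mul_assoc (κ : ℂ), h2, hL, hR, Complex.ext_iff, Complex.re_ofReal_mul, Complex.re_ofReal_mul,
    Complex.im_ofReal_mul, Complex.im_ofReal_mul, Complex.add_re, Complex.add_im, Complex.sub_re,
    Complex.sub_im, Complex.re_ofReal_mul, Complex.im_ofReal_mul, Complex.ofReal_re,
    Complex.ofReal_im, pow_two z, Complex.mul_re, Complex.mul_im, Complex.normSq_apply,
    Complex.normSq_apply]
  constructor
  · rintro ⟨hre, him⟩
    have key : ω ^ 2 * z.re * (w.im * S ^ 3) = κ * (z.re - w.re) * z.im := by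
      apply mul_left_cancel₀ (mul_ne_zero two_ne_zero hz.ne')
      linear_combination him
    refine ⟨?_, key⟩
    apply mul_left_cancel₀ (mul_ne_zero hκ hz.ne')
    linear_combination hre - 2 * z.re * key
  · rintro ⟨hn, key⟩
    constructor
    · linear_combination 2 * z.re * key + κ * z.im * hn
    · linear_combination 2 * z.im * key

theorem sinhDist_fermi (s s' t : ℝ) : sinhDist (fermi s t) (fermi s' t) = |Real.sinh (s - s')| := by
  rw [sinhDist_coe, dist_fermi_left, Real.abs_sinh]

theorem accel_fermi_iff {s s' t t' κ ω : ℝ} (hκ : κ ≠ 0) (h : fermi s t ≠ fermi s' t') :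
    (ω : ℂ) ^ 2 * fermi s t = accel κ (fermi s t) (fermi s' t') (ω * fermi s t) ↔
      t = t' ∧ ω ^ 2 * (Real.sinh s * Real.cosh s) * |Real.sinh (s - s')| ^ 3 =
        κ * Real.sinh (s - s') := by
  have hS : 0 < sinhDist (fermi s t) (fermi s' t') := by
    rw [sinhDist_coe, Real.sinh_pos_iff]; exact dist_pos.2 h
  rw [accel_orbit_iff hκ (fermi s t).im_pos (fermi s' t').im_pos hS, normSq_fermi, normSq_fermi,
    sq_eq_sq₀ (Real.exp_pos _).le (Real.exp_pos _).le, Real.exp_eq_exp]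
  refine and_congr_right ?_
  rintro rfl
  have h1 := Real.cosh_pos s
  have h2 := Real.cosh_pos s'
  have h3 := Real.exp_pos t
  rw [sinhDist_fermi, fermi_re, fermi_im, fermi_im, fermi_re]
  have e1 : κ * (Real.exp t * (Real.sinh s / Real.cosh s) - Real.exp t *
      (Real.sinh s' / Real.cosh s')) * (Real.exp t * (1 / Real.cosh s)) =
      Real.exp t ^ 2 / (Real.cosh s ^ 2 * Real.cosh s') * (κ * Real.sinh (s - s')) := by
    rw [Real.sinh_sub]; field_simp
  have e2 : ω ^ 2 * (Real.exp t * (Real.sinh s / Real.cosh s)) *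
      (Real.exp t * (1 / Real.cosh s') * |Real.sinh (s - s')| ^ 3) =
      Real.exp t ^ 2 / (Real.cosh s ^ 2 * Real.cosh s') *
        (ω ^ 2 * (Real.sinh s * Real.cosh s) * |Real.sinh (s - s')| ^ 3) := by
    field_simp
  rw [e1, e2]
  have h4 : Real.exp t ^ 2 / (Real.cosh s ^ 2 * Real.cosh s') ≠ 0 := by positivity
  exact mul_right_inj' h4

/-- The sign `σ` tells on which side of the axis the first mass lies, and it cancels. For the second
mass, `σ` becomes `-σ` and `d₁`, `d₂` are swapped. Only the sum has to be positive, so this applies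
before the masses are known to be separated by the axis. -/
theorem balance_iff {κ ω σ d₁ d₂ : ℝ} (hσ : σ = 1 ∨ σ = -1) (hd : 0 < d₁ + d₂) :
    ω ^ 2 * (Real.sinh (σ * d₁) * Real.cosh (σ * d₁)) * |Real.sinh (σ * d₁ - -(σ * d₂))| ^ 3 =
        κ * Real.sinh (σ * d₁ - -(σ * d₂)) ↔
      ω ^ 2 * (Real.sinh (d₁ + d₂) ^ 2 * Real.sinh (2 * d₁)) = 2 * κ := by
  have hS : 0 < Real.sinh (d₁ + d₂) := Real.sinh_pos_iff.2 hd
  have e1 : Real.sinh (σ * d₁ - -(σ * d₂)) = σ * Real.sinh (d₁ + d₂) := by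
    rw [sub_neg_eq_add, ← mul_add]
    rcases hσ with rfl | rfl <;> simp [-neg_add_rev, Real.sinh_neg]
  have e2 : Real.sinh (σ * d₁) * Real.cosh (σ * d₁) = σ * (Real.sinh d₁ * Real.cosh d₁) := by
    rcases hσ with rfl | rfl <;> simp
  have e3 : |σ| = 1 := by rcases hσ with rfl | rfl <;> simp
  have h0 : σ ≠ 0 := by rcases hσ with rfl | rfl <;> simp
  rw [e1, e2, abs_mul, e3, one_mul, abs_of_pos hS, Real.sinh_two_mul]
  constructor
  · intro h
    apply mul_left_cancel₀ (mul_ne_zero h0 hS.ne')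
    linear_combination 2 * h
  · intro h
    linear_combination (σ * Real.sinh (d₁ + d₂) / 2) * h

theorem omegaRelation_iff {k m₁ m₂ d₁ d₂ ω : ℝ} (h₁ : 0 < d₁) (h₂ : 0 < d₂) :
    OmegaRelation k m₁ m₂ d₁ d₂ ω ↔
      ω ^ 2 * (Real.sinh (d₁ + d₂) ^ 2 * Real.sinh (2 * d₁)) = 2 * (k * m₂) ∧
      ω ^ 2 * (Real.sinh (d₂ + d₁) ^ 2 * Real.sinh (2 * d₂)) = 2 * (k * m₁) := by
  have hS : 0 < Real.sinh (d₁ + d₂) := Real.sinh_pos_iff.2 (by linarith)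
  have hS₁ : 0 < Real.sinh (2 * d₁) := Real.sinh_pos_iff.2 (by linarith)
  have hS₂ : 0 < Real.sinh (2 * d₂) := Real.sinh_pos_iff.2 (by linarith)
  rw [OmegaRelation, eq_div_iff (by positivity), eq_div_iff (by positivity), add_comm d₂, and_comm,
    mul_assoc, mul_assoc]

theorem OmegaRelation.ne_zero {k m₁ m₂ d₁ d₂ ω : ℝ} (hk : 0 < k) (hm₁ : 0 < m₁) (h₁ : 0 < d₁)
    (h₂ : 0 < d₂) (h : OmegaRelation k m₁ m₂ d₁ d₂ ω) : ω ≠ 0 := by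
  rintro rfl
  have := ((omegaRelation_iff h₁ h₂).1 h).2
  have := mul_pos hk hm₁
  linarith

theorem OmegaRelation.balance {k m₁ m₂ d₁ d₂ ω : ℝ} (hk : 0 < k) (h₁ : 0 < d₁)
    (h₂ : 0 < d₂) (h : OmegaRelation k m₁ m₂ d₁ d₂ ω) :
    m₁ * Real.sinh (2 * d₁) = m₂ * Real.sinh (2 * d₂) := by
  have hS : 0 < Real.sinh (d₁ + d₂) := Real.sinh_pos_iff.2 (by linarith)
  have hS₁ : 0 < Real.sinh (2 * d₁) := Real.sinh_pos_iff.2 (by linarith)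
  have hS₂ : 0 < Real.sinh (2 * d₂) := Real.sinh_pos_iff.2 (by linarith)
  have := h.1.symm.trans h.2
  rw [div_eq_div_iff (by positivity) (by positivity)] at this
  apply mul_left_cancel₀ (show 2 * k * Real.sinh (d₁ + d₂) ^ 2 ≠ 0 by positivity)
  linear_combination this

theorem exists_omega {k m₁ m₂ d₁ d₂ : ℝ} (hk : 0 < k) (hm₂ : 0 < m₂) (h₁ : 0 < d₁)
    (h₂ : 0 < d₂) (h : m₁ * Real.sinh (2 * d₁) = m₂ * Real.sinh (2 * d₂)) :
    ∃ ω, OmegaRelation k m₁ m₂ d₁ d₂ ω := by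
  have hS : 0 < Real.sinh (d₁ + d₂) := Real.sinh_pos_iff.2 (by linarith)
  have hS₁ : 0 < Real.sinh (2 * d₁) := Real.sinh_pos_iff.2 (by linarith)
  have hS₂ : 0 < Real.sinh (2 * d₂) := Real.sinh_pos_iff.2 (by linarith)
  have hsq := Real.sq_sqrt
    (show 0 ≤ 2 * k * m₂ / (Real.sinh (d₁ + d₂) ^ 2 * Real.sinh (2 * d₁)) by positivity)
  refine ⟨_, hsq.trans ?_, hsq⟩
  rw [div_eq_div_iff (by positivity) (by positivity)]
  linear_combination (-2 * k * Real.sinh (d₁ + d₂) ^ 2) * h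

/-- Only the square of the speed enters Newton's equations, so `ω'` may be `ω` or `-ω`, as the
direction of the initial velocities dictates. -/
theorem isMotion_of_orbit {e : M ≃ᵢ ℍ} {k m₁ m₂ σ d₁ d₂ ω ω' : ℝ} (hk : 0 < k) (hm₁ : 0 < m₁)
    (hm₂ : 0 < m₂) {x₁ x₂ : ℝ → M} (hσ : σ = 1 ∨ σ = -1) (h₁ : 0 < d₁) (h₂ : 0 < d₂)
    (hω : OmegaRelation k m₁ m₂ d₁ d₂ ω) (hω' : ω' ^ 2 = ω ^ 2)
    (hx₁ : ∀ t, e (x₁ t) = fermi (σ * d₁) (0 + ω' * t))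
    (hx₂ : ∀ t, e (x₂ t) = fermi (-(σ * d₂)) (0 + ω' * t)) : IsMotion e k m₁ m₂ x₁ x₂ := by
  have hs : σ * d₁ ≠ -(σ * d₂) := by rcases hσ with rfl | rfl <;> intro h <;> linarith
  have hne : ∀ t, fermi (σ * d₁) (0 + ω' * t) ≠ fermi (-(σ * d₂)) (0 + ω' * t) := fun t h =>
    hs (fermi_injective_left h)
  obtain ⟨q₁, q₂⟩ := (omegaRelation_iff h₁ h₂).1 hω
  rw [← hω'] at q₁ q₂
  have q₁ := (balance_iff hσ (by linarith)).2 q₁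
  have q₂ := (balance_iff (σ := -σ) (by rcases hσ with rfl | rfl <;> simp) (by linarith)).2 q₂
  rw [neg_mul, neg_mul, neg_neg] at q₂
  rw [isMotion_iff hm₁ hm₂]
  refine ⟨fun t h => hne t (by rw [← hx₁, ← hx₂, h]),
    fun t => (ω' * coord e (x₁ t), ω' * coord e (x₂ t)),
    fun t => ⟨⟨hasVelocity_orbit hx₁ t, hasVelocity_orbit hx₂ t⟩, ?_, ?_⟩⟩
  · have hv : HasDerivAt (fun s => coord e (x₁ s)) _ t := hasVelocity_orbit hx₁ t
    refine (hv.const_mul (ω' : ℂ)).congr_deriv ?_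
    simp only [← mul_assoc, ← sq, coord, hx₁, hx₂]
    exact (accel_fermi_iff (mul_pos hk hm₂).ne' (hne t)).2 ⟨rfl, q₁⟩
  · have hv : HasDerivAt (fun s => coord e (x₂ s)) _ t := hasVelocity_orbit hx₂ t
    refine (hv.const_mul (ω' : ℂ)).congr_deriv ?_
    simp only [← mul_assoc, ← sq, coord, hx₁, hx₂]
    exact (accel_fermi_iff (mul_pos hk hm₁).ne' (hne t).symm).2 ⟨rfl, q₂⟩

theorem balance_of_orbit {e : M ≃ᵢ ℍ} {k m₁ m₂ s₁ s₂ τ₁ τ₂ ω : ℝ} (hk : 0 < k) (hm₁ : 0 < m₁)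
    (hm₂ : 0 < m₂) {x₁ x₂ : ℝ → M} (hx : IsMotion e k m₁ m₂ x₁ x₂)
    (hx₁ : ∀ t, e (x₁ t) = fermi s₁ (τ₁ + ω * t)) (hx₂ : ∀ t, e (x₂ t) = fermi s₂ (τ₂ + ω * t)) :
    τ₁ = τ₂ ∧ ∃ σ d₁ d₂, (σ = 1 ∨ σ = -1) ∧ 0 < d₁ ∧ 0 < d₂ ∧ s₁ = σ * d₁ ∧ s₂ = -(σ * d₂) ∧
      OmegaRelation k m₁ m₂ d₁ d₂ ω := by
  rw [isMotion_iff hm₁ hm₂] at hx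
  obtain ⟨hne, v, hv⟩ := hx
  have hne : fermi s₁ (τ₁ + ω * 0) ≠ fermi s₂ (τ₂ + ω * 0) := by
    rw [← hx₁, ← hx₂]; exact fun h => hne 0 (e.injective h)
  have hv₁ : (fun t => (v t).1) = fun t => ω * coord e (x₁ t) := funext fun t =>
    HasDerivAt.unique (hv t).1.1 (hasVelocity_orbit hx₁ t)
  have hv₂ : (fun t => (v t).2) = fun t => ω * coord e (x₂ t) := funext fun t =>
    HasDerivAt.unique (hv t).1.2 (hasVelocity_orbit hx₂ t)
  have a₁ := (hv 0).2.1
  have a₂ := (hv 0).2.2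
  rw [hv₁, congrFun hv₁ 0] at a₁
  rw [hv₂, congrFun hv₂ 0] at a₂
  have w₁ : HasDerivAt (fun s => coord e (x₁ s)) _ 0 := hasVelocity_orbit hx₁ 0
  have w₂ : HasDerivAt (fun s => coord e (x₂ s)) _ 0 := hasVelocity_orbit hx₂ 0
  have b₁ := (w₁.const_mul (ω : ℂ)).unique a₁
  have b₂ := (w₂.const_mul (ω : ℂ)).unique a₂
  rw [← mul_assoc, ← sq, coord, coord, hx₁, hx₂, accel_fermi_iff (mul_pos hk hm₂).ne' hne] at b₁
  rw [← mul_assoc, ← sq, coord, coord, hx₁, hx₂, accel_fermi_iff (mul_pos hk hm₁).ne' hne.symm] at b₂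
  have hτ : τ₁ = τ₂ := by linarith [b₁.1]
  subst hτ
  have hs : s₁ ≠ s₂ := fun h => hne (by rw [h])
  -- With `σ` the sign of `s₁ - s₂`, the numbers `d₁ = σ * s₁` and `d₂ = -(σ * s₂)` have positive
  -- sum.
  obtain ⟨σ, hσ, hσs⟩ : ∃ σ : ℝ, (σ = 1 ∨ σ = -1) ∧ 0 < σ * (s₁ - s₂) := by
    rcases hs.lt_or_gt with h | h
    · exact ⟨-1, Or.inr rfl, by linarith⟩
    · exact ⟨1, Or.inl rfl, by linarith⟩
  have hσ2 : σ * σ = 1 := by rcases hσ with rfl | rfl <;> simp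
  have e₁ : s₁ = σ * (σ * s₁) := by rw [← mul_assoc, hσ2, one_mul]
  have e₂ : s₂ = -(σ * (-(σ * s₂))) := by rw [mul_neg, neg_neg, ← mul_assoc, hσ2, one_mul]
  generalize σ * s₁ = d₁ at *
  generalize -(σ * s₂) = d₂ at *
  subst e₁ e₂
  have hd : 0 < d₁ + d₂ := by linear_combination hσs + (d₁ + d₂) * hσ2
  have q₁ := (balance_iff hσ hd).1 b₁.2
  have q₂ := b₂.2
  rw [show -(σ * d₂) = -σ * d₂ by ring, show σ * d₁ = -(-σ * d₁) by ring,
    balance_iff (by rcases hσ with rfl | rfl <;> simp) (by linarith)] at q₂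
  -- The balance with an attractive force makes `sinh (2 * d)` positive, which places the masses on
  -- opposite sides of the axis.
  have pos : ∀ {a d κ : ℝ}, 0 < κ → ω ^ 2 * (a ^ 2 * Real.sinh (2 * d)) = 2 * κ → 0 < d := by
    intro a d κ hκ h
    by_contra hd
    have : Real.sinh (2 * d) ≤ 0 := Real.sinh_nonpos_iff.2 (by linarith)
    nlinarith [mul_nonneg (sq_nonneg (ω * a)) (neg_nonneg.2 this)]
  have h₁ := pos (mul_pos hk hm₂) q₁
  have h₂ := pos (mul_pos hk hm₁) q₂
  exact ⟨rfl, σ, d₁, d₂, hσ, h₁, h₂, rfl, rfl, (omegaRelation_iff h₁ h₂).2 ⟨q₁, q₂⟩⟩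

/-! ### Hyperbolic one-parameter groups -/

/-- The factor `2` appears because a diagonal matrix with entries `exp (± r t)` multiplies `z` by
the square of `exp (r t)`. -/
theorem coe_translation (r t : ℝ) :
    (translation (2 * r * t) : Matrix (Fin 2) (Fin 2) ℝ) =
      NormedSpace.exp (t • Matrix.diagonal ![r, -r]) := by
  rw [← Matrix.diagonal_smul, Matrix.exp_diagonal]
  ext i j
  fin_cases i <;> fin_cases j <;>
    simp [translation, Pi.coe_exp, Real.exp_eq_exp_ℝ] <;> ring_nf

theorem exp_conj_diagonal (Q : SL(2, ℝ)) (r t : ℝ) :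
    NormedSpace.exp (t • ((Q : Matrix (Fin 2) (Fin 2) ℝ) * Matrix.diagonal ![r, -r] *
      ((Q⁻¹ : SL(2, ℝ)) : Matrix (Fin 2) (Fin 2) ℝ))) =
      ((Q * translation (2 * r * t) * Q⁻¹ : SL(2, ℝ)) : Matrix (Fin 2) (Fin 2) ℝ) := by
  have hinv : ((Q⁻¹ : SL(2, ℝ)) : Matrix (Fin 2) (Fin 2) ℝ) = (Q : Matrix (Fin 2) (Fin 2) ℝ)⁻¹ := by
    rw [Matrix.SpecialLinearGroup.coe_inv, Matrix.inv_def, Q.det_coe]; simp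
  have hu : IsUnit (Q : Matrix (Fin 2) (Fin 2) ℝ) := by
    rw [Matrix.isUnit_iff_isUnit_det, Q.det_coe]; exact isUnit_one
  rw [Matrix.SpecialLinearGroup.coe_mul, Matrix.SpecialLinearGroup.coe_mul, hinv, coe_translation,
    ← Matrix.exp_conj _ _ hu, Matrix.mul_smul, Matrix.smul_mul]

theorem IsHyperbolicElement.exists_diagonal {ξ : Matrix (Fin 2) (Fin 2) ℝ}
    (h : IsHyperbolicElement ξ) : ∃ (r : ℝ) (Q : SL(2, ℝ)), r ≠ 0 ∧
      ξ = (Q : Matrix (Fin 2) (Fin 2) ℝ) * Matrix.diagonal ![r, -r] *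
        ((Q⁻¹ : SL(2, ℝ)) : Matrix (Fin 2) (Fin 2) ℝ) := by
  obtain ⟨-, r, hr, h₁, h₂⟩ := h
  obtain ⟨u, hu⟩ := h₁.exists_hasEigenvector
  obtain ⟨w, hw⟩ := h₂.exists_hasEigenvector
  have hu' := hu.apply_eq_smul
  have hw' := hw.apply_eq_smul
  have u0 := congrFun hu' 0
  have u1 := congrFun hu' 1
  have w0 := congrFun hw' 0
  have w1 := congrFun hw' 1
  simp [Matrix.toLin'_apply, Matrix.mulVec, dotProduct, Fin.sum_univ_two] at u0 u1 w0 w1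
  -- Eigenvectors for `r ≠ -r` are independent: if the determinant vanished, the eigenvalue
  -- equations would make every product `u i * w j` zero.
  have hD : u 0 * w 1 - u 1 * w 0 ≠ 0 := by
    intro hD
    have z00 : u 0 * w 0 = 0 := by
      apply mul_left_cancel₀ hr
      linear_combination (1 / 2) * (u 0 * w0 - w 0 * u0 - ξ 0 1 * hD)
    have z01 : u 0 * w 1 = 0 := by
      apply mul_left_cancel₀ hr
      linear_combination (1 / 2) * (u 1 * w0 - w 1 * u0 + (r + ξ 0 0) * hD)
    have z10 : u 1 * w 0 = 0 := by linarith
    have z11 : u 1 * w 1 = 0 := by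
      apply mul_left_cancel₀ hr
      linear_combination (1 / 2) * (u 1 * w1 - w 1 * u1 + ξ 1 0 * hD)
    apply hw.2
    have huc : u 0 ≠ 0 ∨ u 1 ≠ 0 := by
      by_contra hc
      push Not at hc
      exact hu.2 (funext fun i => by fin_cases i <;> simp [hc.1, hc.2])
    funext i
    rcases huc with hc | hc <;> fin_cases i <;> simp_all
  -- Dividing the second eigenvector by the determinant puts the base change into `SL(2, ℝ)`.
  have hdet : (!![u 0, w 0 / (u 0 * w 1 - u 1 * w 0);
      u 1, w 1 / (u 0 * w 1 - u 1 * w 0)] : Matrix (Fin 2) (Fin 2) ℝ).det = 1 := by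
    rw [Matrix.det_fin_two_of]; field_simp
  refine ⟨r, ⟨_, hdet⟩, hr, ?_⟩
  generalize u 0 * w 1 - u 1 * w 0 = D at *
  set Q : SL(2, ℝ) := ⟨_, hdet⟩ with hQ
  have hcomm : ξ * (Q : Matrix (Fin 2) (Fin 2) ℝ) =
      (Q : Matrix (Fin 2) (Fin 2) ℝ) * Matrix.diagonal ![r, -r] := by
    ext i j
    fin_cases i <;> fin_cases j <;> simp [hQ, Matrix.mul_apply, Fin.sum_univ_two]
    · linear_combination u0
    · linear_combination (1 / D) * w0
    · linear_combination u1
    · linear_combination (1 / D) * w1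
  rw [← hcomm, mul_assoc, ← Matrix.SpecialLinearGroup.coe_mul, mul_inv_cancel,
    Matrix.SpecialLinearGroup.coe_one, mul_one]

theorem isHyperbolicElement_conj (Q : SL(2, ℝ)) {r : ℝ} (hr : r ≠ 0) :
    IsHyperbolicElement ((Q : Matrix (Fin 2) (Fin 2) ℝ) * Matrix.diagonal ![r, -r] *
        ((Q⁻¹ : SL(2, ℝ)) : Matrix (Fin 2) (Fin 2) ℝ)) := by
  have hinv : ((Q⁻¹ : SL(2, ℝ)) : Matrix (Fin 2) (Fin 2) ℝ) * Q = 1 := by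
    rw [← Matrix.SpecialLinearGroup.coe_mul, inv_mul_cancel, Matrix.SpecialLinearGroup.coe_one]
  have key : ∀ (v : Fin 2 → ℝ) (c : ℝ), v ≠ 0 → (Matrix.diagonal ![r, -r]).mulVec v = c • v →
      Module.End.HasEigenvalue (Matrix.toLin' ((Q : Matrix (Fin 2) (Fin 2) ℝ) *
        Matrix.diagonal ![r, -r] * ((Q⁻¹ : SL(2, ℝ)) : Matrix (Fin 2) (Fin 2) ℝ))) c := by
    intro v c hv h
    apply Module.End.hasEigenvalue_of_hasEigenvector (x := (Q : Matrix (Fin 2) (Fin 2) ℝ).mulVec v)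
    refine ⟨Module.End.mem_eigenspace_iff.2 ?_, fun h0 => hv ?_⟩
    · rw [Matrix.toLin'_apply, Matrix.mulVec_mulVec, mul_assoc, hinv, mul_one,
        ← Matrix.mulVec_mulVec, h, Matrix.mulVec_smul]
    · have := congrArg (fun y => ((Q⁻¹ : SL(2, ℝ)) : Matrix (Fin 2) (Fin 2) ℝ).mulVec y) h0
      simpa only [Matrix.mulVec_mulVec, hinv, Matrix.one_mulVec, Matrix.mulVec_zero] using this
  refine ⟨?_, r, hr, key ![1, 0] r ?_ ?_, key ![0, 1] (-r) ?_ ?_⟩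
  · rw [Matrix.trace_mul_comm, ← mul_assoc, hinv, one_mul]
    simp [Matrix.trace, Fin.sum_univ_two]
  · exact fun h => one_ne_zero (congrFun h 0)
  · ext i; fin_cases i <;> simp [Matrix.mulVec_diagonal]
  · exact fun h => one_ne_zero (congrFun h 1)
  · ext i; fin_cases i <;> simp [Matrix.mulVec_diagonal]

/-- The chart is moved by the inverse of the matrix diagonalizing `ξ`, which takes the axis of the
group to the imaginary axis. -/
theorem IsHyperbolicRelEquilibrium.exists_chart {e : M ≃ᵢ ℍ} {k m₁ m₂ : ℝ} {x₁ x₂ : ℝ → M}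
    (h : IsHyperbolicRelEquilibrium e k m₁ m₂ x₁ x₂) :
    ∃ (g : SL(2, ℝ)) (ω s₁ s₂ τ₁ τ₂ : ℝ),
      (∀ t, moveChart e g (x₁ t) = fermi s₁ (τ₁ + ω * t)) ∧
      (∀ t, moveChart e g (x₂ t) = fermi s₂ (τ₂ + ω * t)) := by
  obtain ⟨-, ξ, hξ, h⟩ := h
  obtain ⟨r, Q, hr, rfl⟩ := hξ.exists_diagonal
  obtain ⟨s₁, τ₁, h₁⟩ := exists_fermi (Q⁻¹ • e (x₁ 0))
  obtain ⟨s₂, τ₂, h₂⟩ := exists_fermi (Q⁻¹ • e (x₂ 0))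
  have key : ∀ t, e (x₁ t) = (Q * translation (2 * r * t) * Q⁻¹) • e (x₁ 0) ∧
      e (x₂ t) = (Q * translation (2 * r * t) * Q⁻¹) • e (x₂ 0) := by
    intro t
    obtain ⟨g, hg, h⟩ := h t
    rw [exp_conj_diagonal] at hg
    rwa [Subtype.ext hg] at h
  refine ⟨Q⁻¹, 2 * r, s₁, s₂, τ₁, τ₂, fun t => ?_, fun t => ?_⟩
  · rw [moveChart_apply, (key t).1, smul_smul, mul_assoc, inv_mul_cancel_left, mul_smul, ← h₁,
      translation_smul_fermi]
  · rw [moveChart_apply, (key t).2, smul_smul, mul_assoc, inv_mul_cancel_left, mul_smul, ← h₂,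
      translation_smul_fermi]

theorem isHyperbolicRelEquilibrium_of_chart {e : M ≃ᵢ ℍ} {k m₁ m₂ : ℝ} {x₁ x₂ : ℝ → M}
    (h : IsMotion e k m₁ m₂ x₁ x₂) (g : SL(2, ℝ)) {ω s₁ s₂ τ₁ τ₂ : ℝ} (hω : ω ≠ 0)
    (h₁ : ∀ t, moveChart e g (x₁ t) = fermi s₁ (τ₁ + ω * t))
    (h₂ : ∀ t, moveChart e g (x₂ t) = fermi s₂ (τ₂ + ω * t)) :
    IsHyperbolicRelEquilibrium e k m₁ m₂ x₁ x₂ := by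
  refine ⟨h, _, isHyperbolicElement_conj g⁻¹ (r := ω / 2) (by positivity), fun t =>
    ⟨_, (exp_conj_diagonal g⁻¹ (ω / 2) t).symm, ?_, ?_⟩⟩
  · rw [mul_smul, mul_smul, inv_inv, ← moveChart_apply, h₁, translation_smul_fermi,
      eq_inv_smul_iff, ← moveChart_apply, h₁]
    congr 1; ring
  · rw [mul_smul, mul_smul, inv_inv, ← moveChart_apply, h₂, translation_smul_fermi,
      eq_inv_smul_iff, ← moveChart_apply, h₂]
    congr 1; ring

/-! ### The main theorem -/

theorem abs_sign_mul {σ d : ℝ} (hσ : σ = 1 ∨ σ = -1) (hd : 0 < d) : |σ * d| = d := by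
  rcases hσ with rfl | rfl <;> simp [abs_of_pos hd]

theorem cosh_sign_mul {σ : ℝ} (hσ : σ = 1 ∨ σ = -1) (d : ℝ) : Real.cosh (σ * d) = Real.cosh d := by
  rcases hσ with rfl | rfl <;> simp

theorem isCenterOfMass_of_signs (e : M ≃ᵢ ℍ) {m₁ m₂ : ℝ} {a₁ a₂ c : M} {σ d₁ d₂ τ : ℝ}
    (hσ : σ = 1 ∨ σ = -1) (hd₁ : 0 < d₁) (hd₂ : 0 < d₂) (h₁ : e a₁ = fermi (σ * d₁) τ)
    (h₂ : e a₂ = fermi (-(σ * d₂)) τ) (hc : e c = fermi 0 τ)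
    (hb : m₁ * Real.sinh (2 * d₁) = m₂ * Real.sinh (2 * d₂)) :
    IsCenterOfMass m₁ m₂ a₁ a₂ c ∧ dist a₁ c = d₁ ∧ dist a₂ c = d₂ := by
  refine ⟨isCenterOfMass_of_chart e h₁ h₂ hc ?_ ?_, ?_, ?_⟩
  · have := mul_pos hd₁ hd₂
    rcases hσ with rfl | rfl <;> nlinarith
  · rw [abs_neg, abs_sign_mul hσ hd₁, abs_sign_mul hσ hd₂, hb]
  · rw [← e.isometry.dist_eq, h₁, hc, dist_fermi_left, sub_zero, abs_sign_mul hσ hd₁]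
  · rw [← e.isometry.dist_eq, h₂, hc, dist_fermi_left, sub_zero, abs_neg, abs_sign_mul hσ hd₂]

theorem IsHyperbolicRelEquilibrium.intrinsicDescription {e : M ≃ᵢ ℍ} {k m₁ m₂ : ℝ} (hk : 0 < k)
    (hm₁ : 0 < m₁) (hm₂ : 0 < m₂) {x₁ x₂ : ℝ → M}
    (h : IsHyperbolicRelEquilibrium e k m₁ m₂ x₁ x₂) : IntrinsicDescription e k m₁ m₂ x₁ x₂ := by
  obtain ⟨g, ω, s₁, s₂, τ, τ', hx₁, hx₂⟩ := h.exists_chart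
  have hmot := h.1.moveChart hm₁ hm₂ g
  obtain ⟨rfl, σ, d₁, d₂, hσ, hd₁, hd₂, rfl, rfl, hω⟩ :=
    balance_of_orbit hk hm₁ hm₂ hmot hx₁ hx₂
  have hω0 := hω.ne_zero hk hm₁ hd₁ hd₂
  rw [← moveChart_inv e g]
  apply IntrinsicDescription.moveChart
  generalize moveChart e g = e at *
  have hC : ∀ t, e (e.symm (fermi 0 (τ + ω * t))) = fermi 0 (τ + ω * t) := fun t =>
    e.apply_symm_apply _
  have hcm := fun t => isCenterOfMass_of_signs e hσ hd₁ hd₂ (hx₁ t) (hx₂ t) (hC t)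
    (hω.balance hk hd₁ hd₂)
  refine ⟨fun t => e.symm (fermi 0 (τ + ω * t)), d₁, d₂, ω, fun t => e.symm (fermi 0 t),
    fun t c => ⟨fun hc => isCenterOfMass_unique e hm₁ hm₂ (hmot.1 t) (hcm t).1 hc,
      fun hc => hc ▸ (hcm t).1⟩, hω, isGeodesic_fermi_zero e, fun t => ⟨(hcm t).2.1, (hcm t).2.2,
      ?_, fun s => e.symm (fermi s (τ + ω * t)), _, _, _, hasVelocity_orbit hx₁ t,
      hasVelocity_orbit hx₂ t, hasVelocity_orbit hC t, perpEquallyOriented_fermi hω0 (hx₁ t) (hx₂ t),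
      ?_, ?_, perpAt_fermi (hC t), ?_⟩⟩
  · rw [← (hcm t).1.dist_add, (hcm t).2.1, (hcm t).2.2]
  · rw [hypNorm_fermi (hx₁ t), cosh_sign_mul hσ]
  · rw [hypNorm_fermi (hx₂ t), Real.cosh_neg, cosh_sign_mul hσ]
  · rw [hypNorm_fermi (hC t), Real.cosh_zero, mul_one]

theorem exists_instantDescription (e : M ≃ᵢ ℍ) {k m₁ m₂ : ℝ} (hk : 0 < k)
    (hm₁ : 0 < m₁) (hm₂ : 0 < m₂) {a₁ a₂ : M} (h : a₁ ≠ a₂) :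
    ∃ u₁ u₂ : ℂ, InstantDescription e k m₁ m₂ a₁ a₂ u₁ u₂ := by
  obtain ⟨g, hg₁, hg₂⟩ := exists_smul_eq_fermi (e a₁) (e a₂)
  rw [e.isometry.dist_eq] at hg₂
  have hd := dist_pos.2 h
  generalize dist a₁ a₂ = d at *
  obtain ⟨a, ha₀, had, hb⟩ := exists_sinh_balance hm₁ hm₂ hd.le
  have hpos : 0 < a ∧ 0 < d - a := by
    constructor
    · rcases ha₀.eq_or_lt with rfl | h0
      · have := mul_pos hm₂ (Real.sinh_pos_iff.2 (show 0 < 2 * (d - 0) by linarith))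
        rw [mul_zero, Real.sinh_zero, mul_zero] at hb
        linarith
      · exact h0
    · rcases had.eq_or_lt with rfl | h0
      · have := mul_pos hm₁ (Real.sinh_pos_iff.2 (show 0 < 2 * a by linarith))
        rw [sub_self, mul_zero, Real.sinh_zero, mul_zero] at hb
        linarith
      · linarith
  obtain ⟨ω, hω⟩ := exists_omega hk hm₂ hpos.1 hpos.2 hb
  -- The first chart puts the masses at parameters `0` and `d` of the semicircle; this one shifts
  -- the parameter by `a`, bringing the center of mass to `fermi 0 0`. The velocities are then `ω`
  -- times the positions.
  obtain ⟨g', hg'⟩ := (isGeodesic_fermi_left (moveChart e g) 0).exists_chart (moveChart e g) a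
  have h₁ : moveChart (moveChart e g) g' a₁ = fermi (-1 * a) 0 := by
    have := hg' 0
    rwa [← hg₁, ← moveChart_apply, IsometryEquiv.symm_apply_apply, zero_sub, neg_eq_neg_one_mul] at this
  have h₂ : moveChart (moveChart e g) g' a₂ = fermi (-(-1 * (d - a))) 0 := by
    have := hg' d
    rwa [← hg₂, ← moveChart_apply, IsometryEquiv.symm_apply_apply,
      show d - a = -(-1 * (d - a)) by ring] at this
  obtain ⟨hc, hc₁, hc₂⟩ := isCenterOfMass_of_signs _ (Or.inr rfl) hpos.1 hpos.2 h₁ h₂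
    (IsometryEquiv.apply_symm_apply _ _) hb
  obtain ⟨u₁, u₂, key⟩ : ∃ u₁ u₂,
      InstantDescription (moveChart (moveChart e g) g') k m₁ m₂ a₁ a₂ u₁ u₂ := by
    refine ⟨_, _, _, ω, hc, by rwa [hc₁, hc₂], ⟨_, perpEquallyOriented_fermi
      (hω.ne_zero hk hm₁ hpos.1 hpos.2) h₁ h₂⟩, ?_, ?_⟩
    · rw [hypNorm_fermi h₁, hc₁, cosh_sign_mul (Or.inr rfl)]
    · rw [hypNorm_fermi h₂, hc₂, Real.cosh_neg, cosh_sign_mul (Or.inr rfl)]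
  have := (key.moveChart g'⁻¹).moveChart g⁻¹
  rw [moveChart_inv, moveChart_inv] at this
  exact ⟨_, _, this⟩

/-- A tangent vector perpendicular to the semicircle is a real multiple of the position. -/
theorem eq_smul_of_perp {e : M ≃ᵢ ℍ} {l : ℝ → M} {s s₀ : ℝ} {u w : ℂ}
    (hl : ∀ s, e (l s) = fermi (s - s₀) 0) (hw : HasVelocity e l w s)
    (h : hypInner (coord e (l s)) u w = 0) : ∃ c : ℝ, u = c * coord e (l s) ∧
      orient u w = -c * (1 / Real.cosh (s - s₀) * Complex.normSq (coord e (l s))) := by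
  have hz := coord_im_pos e (l s)
  have hw' : w = ((1 / Real.cosh (s - s₀) : ℝ) : ℂ) * (-Complex.I * coord e (l s)) := by
    have h1 := (hasDerivAt_fermi_left (s - s₀) 0).comp_sub_const s s₀
    have hw : HasDerivAt (fun s => coord e (l s)) w s := hw
    simp only [coord, hl] at hw ⊢
    exact hw.unique h1
  have hc := Real.cosh_pos (s - s₀)
  generalize coord e (l s) = z at *
  subst hw'
  have h0 : u.re * z.im - u.im * z.re = 0 := by
    rw [hypInner, div_eq_zero_iff, or_iff_left (by positivity)] at h
    simp only [Complex.re_ofReal_mul, Complex.im_ofReal_mul] at h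
    simp at h
    field_simp at h
    linarith
  have hu : u = ((u.im / z.im : ℝ) : ℂ) * z := by
    apply Complex.ext
    · rw [Complex.re_ofReal_mul]; field_simp; linarith
    · rw [Complex.im_ofReal_mul]; field_simp
  refine ⟨u.im / z.im, hu, ?_⟩
  generalize u.im / z.im = c at *
  subst hu
  rw [orient, Complex.normSq_apply]
  simp only [Complex.re_ofReal_mul, Complex.im_ofReal_mul]
  simp
  ring

theorem InstantDescription.exists_motion {e : M ≃ᵢ ℍ} {k m₁ m₂ : ℝ} (hk : 0 < k)
    (hm₁ : 0 < m₁) (hm₂ : 0 < m₂) {a₁ a₂ : M} {u₁ u₂ : ℂ} (ha : a₁ ≠ a₂)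
    (h : InstantDescription e k m₁ m₂ a₁ a₂ u₁ u₂) : ∃ x₁ x₂ : ℝ → M,
        IsHyperbolicRelEquilibrium e k m₁ m₂ x₁ x₂ ∧ x₁ 0 = a₁ ∧ x₂ 0 = a₂ ∧
          HasVelocity e x₁ u₁ 0 ∧ HasVelocity e x₂ u₂ 0 := by
  obtain ⟨c, ω, hc, hω, ⟨l, hl⟩, hn₁, hn₂⟩ := h
  have hd := hc.dist_add
  obtain ⟨hd₁, hd₂⟩ := hc.dist_pos hm₁ hm₂ ha
  generalize dist a₁ c = d₁ at *
  generalize dist a₂ c = d₂ at *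
  obtain ⟨s₁, s₂, -, -, rfl, rfl, -⟩ := hl.2
  have hgeo : Isometry l := hl.1
  rw [hgeo.dist_eq, Real.dist_eq] at hd
  obtain ⟨σ, hσ, hσs⟩ : ∃ σ : ℝ, (σ = 1 ∨ σ = -1) ∧ s₁ - s₂ = σ * (d₁ + d₂) := by
    rcases le_total s₁ s₂ with h | h
    · rw [abs_of_nonpos (by linarith)] at hd
      exact ⟨-1, Or.inr rfl, by linarith⟩
    · rw [abs_of_nonneg (by linarith)] at hd
      exact ⟨1, Or.inl rfl, by linarith⟩
  -- The parameter `s₁ - σ * d₁` is the one at distance `d₁` from the first and `d₂` from the second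
  -- mass; it goes to `fermi 0 0`.
  obtain ⟨g, hg⟩ := hl.1.exists_chart e (s₁ - σ * d₁)
  have hl' := hl.moveChart g
  have hn₁' := hypNorm_moveChart e g (l s₁) u₁
  have hn₂' := hypNorm_moveChart e g (l s₂) u₂
  obtain ⟨-, t₁, t₂, w₁, w₂, ht₁, ht₂, hw₁, hw₂, hp₁, hp₂, ho⟩ := hl'
  obtain rfl := hgeo.injective ht₁
  obtain rfl := hgeo.injective ht₂
  obtain ⟨c₁, hc₁, ho₁⟩ := eq_smul_of_perp hg hw₁ hp₁
  obtain ⟨c₂, hc₂, ho₂⟩ := eq_smul_of_perp hg hw₂ hp₂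
  have h₁ : HypTwoBody.moveChart e g (l t₁) = fermi (σ * d₁) 0 := by rw [hg]; congr 1; ring
  have h₂ : HypTwoBody.moveChart e g (l t₂) = fermi (-(σ * d₂)) 0 := by
    rw [hg]; congr 1; linear_combination -hσs
  rw [hc₁, hypNorm_fermi h₁, hn₁, cosh_sign_mul hσ] at hn₁'
  rw [hc₂, hypNorm_fermi h₂, hn₂, Real.cosh_neg, cosh_sign_mul hσ] at hn₂'
  have ha₁ := mul_right_cancel₀ (Real.cosh_pos _).ne' hn₁'
  have ha₂ := mul_right_cancel₀ (Real.cosh_pos _).ne' hn₂'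
  -- Both orientations are negative multiples of `c₁` and `c₂`, so equal orientation gives equal
  -- signs; the norms give `|c₁| = |ω| = |c₂|`.
  have hcc : 0 < c₁ * c₂ := by
    rw [ho₁, ho₂, mul_mul_mul_comm, neg_mul_neg] at ho
    by_contra hcon
    have hnonneg : ∀ (x : ℝ) (z : ℂ), 0 ≤ 1 / Real.cosh x * Complex.normSq z := fun x z =>
      mul_nonneg (one_div_pos.2 (Real.cosh_pos x)).le (Complex.normSq_nonneg z)
    exact absurd ho (not_lt.2 (mul_nonpos_of_nonpos_of_nonneg (not_lt.1 hcon)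
      (mul_nonneg (hnonneg _ _) (hnonneg _ _))))
  have hceq : c₁ = c₂ := by
    rcases abs_eq_abs.1 (ha₁.trans ha₂.symm) with h | h
    · exact h
    · rw [h] at hcc; nlinarith [sq_nonneg c₂]
  subst hceq
  have hc0 : c₁ ≠ 0 := fun h => by rw [h] at hcc; simp at hcc
  have hsq : c₁ ^ 2 = ω ^ 2 := sq_eq_sq_iff_abs_eq_abs _ _ |>.2 ha₁
  set e' := HypTwoBody.moveChart e g with he'
  have hx₁ : ∀ t, e' (e'.symm (fermi (σ * d₁) (0 + c₁ * t))) = fermi (σ * d₁) (0 + c₁ * t) :=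
    fun t => e'.apply_symm_apply _
  have hx₂ : ∀ t, e' (e'.symm (fermi (-(σ * d₂)) (0 + c₁ * t))) = fermi (-(σ * d₂)) (0 + c₁ * t) :=
    fun t => e'.apply_symm_apply _
  have hmot := isMotion_of_orbit hk hm₁ hm₂ hσ hd₁ hd₂ hω hsq hx₁ hx₂
  have i₁ : e'.symm (fermi (σ * d₁) (0 + c₁ * 0)) = l t₁ := by
    rw [mul_zero, add_zero, ← h₁, e'.symm_apply_apply]
  have i₂ : e'.symm (fermi (-(σ * d₂)) (0 + c₁ * 0)) = l t₂ := by
    rw [mul_zero, add_zero, ← h₂, e'.symm_apply_apply]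
  have hv : ∀ (x : ℝ → M) (a : M) (u : ℂ), HasVelocity e' x (c₁ * coord e' a) 0 → x 0 = a →
      slDeriv g (coord e a) * u = c₁ * coord e' a → HasVelocity e x u 0 := by
    rintro x _ u hx rfl hu
    rw [← hu] at hx
    have h1 := hx.moveChart g⁻¹
    -- Some velocity exists in the chart `e`. Moving it forward and using uniqueness of the
    -- derivative identifies it, without multiplying out the derivatives of `g` and `g⁻¹`.
    have h2 : ∀ w : ℂ, HasVelocity e x w 0 → w = u := by
      intro w hw
      have := HasDerivAt.unique (hw.moveChart g) hx
      exact mul_left_cancel₀ (slDeriv_coord_ne_zero g e _) this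
    rw [he', moveChart_inv] at h1
    rwa [h2 _ h1] at h1
  refine ⟨_, _, isHyperbolicRelEquilibrium_of_chart ?_ g hc0 hx₁ hx₂, i₁, i₂, ?_, ?_⟩
  · have := hmot.moveChart hm₁ hm₂ g⁻¹
    rwa [he', moveChart_inv] at this
  · exact hv _ _ _ (i₁ ▸ hasVelocity_orbit hx₁ 0) i₁ hc₁
  · exact hv _ _ _ (i₂ ▸ hasVelocity_orbit hx₂ 0) i₂ hc₂

theorem IntrinsicDescription.instantDescription {e : M ≃ᵢ ℍ} {k m₁ m₂ : ℝ} {x₁ x₂ : ℝ → M}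
    (h : IntrinsicDescription e k m₁ m₂ x₁ x₂) (t : ℝ) : ∃ u₁ u₂ : ℂ,
      HasVelocity e x₁ u₁ t ∧ HasVelocity e x₂ u₂ t ∧
      InstantDescription e k m₁ m₂ (x₁ t) (x₂ t) u₁ u₂ := by
  obtain ⟨C, d₁, d₂, ω, p, hC, hω, hp, h⟩ := h
  obtain ⟨h1, h2, -, l, v₁, v₂, v, hv₁, hv₂, -, hl, n₁, n₂, -, -⟩ := h t
  exact ⟨v₁, v₂, hv₁, hv₂, C t, ω, (hC t _).2 rfl, by rwa [h1, h2], ⟨l, hl⟩, by rwa [h1], by rwa [h2]⟩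

end HypTwoBody

theorem mainTheorem5 {M : Type*} [MetricSpace M] (e : M ≃ᵢ UpperHalfPlane) (k m₁ m₂ : ℝ)
    (hk : 0 < k) (hm₁ : 0 < m₁) (hm₂ : 0 < m₂) :
    (∀ x₁ x₂ : ℝ → M, HypTwoBody.IsMotion e k m₁ m₂ x₁ x₂ →
      (HypTwoBody.IsHyperbolicRelEquilibrium e k m₁ m₂ x₁ x₂ ↔
        HypTwoBody.IntrinsicDescription e k m₁ m₂ x₁ x₂)) ∧
    (∀ a₁ a₂ : M, a₁ ≠ a₂ →
      ∃ u₁ u₂ : ℂ, HypTwoBody.InstantDescription e k m₁ m₂ a₁ a₂ u₁ u₂) ∧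
    (∀ (a₁ a₂ : M) (u₁ u₂ : ℂ), a₁ ≠ a₂ →
      HypTwoBody.InstantDescription e k m₁ m₂ a₁ a₂ u₁ u₂ →
      ∃ x₁ x₂ : ℝ → M,
        HypTwoBody.IsHyperbolicRelEquilibrium e k m₁ m₂ x₁ x₂ ∧
        (x₁ 0 = a₁ ∧ x₂ 0 = a₂ ∧
          HypTwoBody.HasVelocity e x₁ u₁ 0 ∧ HypTwoBody.HasVelocity e x₂ u₂ 0) ∧
        ∀ y₁ y₂ : ℝ → M, HypTwoBody.IsMotion e k m₁ m₂ y₁ y₂ →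
          y₁ 0 = a₁ → y₂ 0 = a₂ →
          HypTwoBody.HasVelocity e y₁ u₁ 0 → HypTwoBody.HasVelocity e y₂ u₂ 0 →
          y₁ = x₁ ∧ y₂ = x₂) := by
  refine ⟨fun x₁ x₂ hx => ⟨fun h => h.intrinsicDescription hk hm₁ hm₂, fun h => ?_⟩,
    fun a₁ a₂ ha => HypTwoBody.exists_instantDescription e hk hm₁ hm₂ ha,
    fun a₁ a₂ u₁ u₂ ha h => ?_⟩
  -- The state at time `0` alone determines a relative equilibrium, and the given motion must
  -- coincide with it.
  · obtain ⟨u₁, u₂, hu₁, hu₂, hi⟩ := h.instantDescription 0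
    obtain ⟨y₁, y₂, hy, i₁, i₂, hv₁, hv₂⟩ := hi.exists_motion hk hm₁ hm₂ (hx.1 0)
    obtain ⟨rfl, rfl⟩ := hy.1.unique hm₁ hm₂ hx i₁.symm i₂.symm hv₁ hv₂ hu₁ hu₂
    exact hy
  · obtain ⟨x₁, x₂, hx, i₁, i₂, hv₁, hv₂⟩ := h.exists_motion hk hm₁ hm₂ ha
    exact ⟨x₁, x₂, hx, ⟨i₁, i₂, hv₁, hv₂⟩, fun y₁ y₂ hy j₁ j₂ hw₁ hw₂ =>
      hx.1.unique hm₁ hm₂ hy (j₁.trans i₁.symm) (j₂.trans i₂.symm) hv₁ hv₂ hw₁ hw₂⟩
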